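/- Let $q_0$ be a prime power, $q=q_0^2$, let $m\ge 1$ be a divisor of $q-1$, and put $d=\gcd(m,q_0+1)$. Let $K$ be an algebraic closure of $\mathbb F_q$. Let $\mathcal H$ be the Hermitian curve $Y^{q_0+1}=X^{q_0}+X$, let $\mathcal X_m$ be the nonsingular projective model of the plane curve $Y^{(q-1)/m}=X(X+1)^{q_0-1}$, and let $$\varphi:\mathcal H\to\mathcal X_m,\qquad (x,y)\mapsto (x^{q_0-1},\,y^m).$$ Points are taken over $K$, and $e_P$ denotes the ramification index of $\varphi$ at a point $P$ of $\mathcal H$. Let $P_0=(0,0)$, let $P_\infty$ be the unique point at infinity of $\mathcal H$, and let $P_1,\dots,P_{q_0-1}$ be the $q_0-1$ distinct points $(a,0)$ of $\mathcal H$ with $a^{q_0-1}=-1$. Then $$e_{P_0}=e_{P_\infty}=m,\qquad e_{P_i}=d\quad(1\le i\le q_0-1),\qquad e_P=1\ \text{ for every other point } P \text{ of } \mathcal H .$$ In particular, if $d>1$, then the ramification points of $\varphi$ (the points $P$ with $e_P>1$) are exactly $P_0,P_\infty,P_1,\dots,P_{q_0-1}$; if $d=1$ and $m>1$, they are exactly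 $P_0$ and $P_\infty$. -/

import Mathlib

open Polynomial

noncomputable section

namespace Hermitian

/-! ## Points of nonsingular curves, as places of function fields -/

/-- A place of a function field `L` over an algebraically closed constant field `K`: a valuation
ring of `L` that contains `K` and is different from `L`. When `L` is a function field in one
variable over `K`, such rings are the local rings at the points of the nonsingular projective
model of `L`, so that `Place K L` is the set of points of that curve. -/
@[ext]
structure Place (K L : Type*) [Field K] [Field L] [Algebra K L] where
  /-- the local ring of the point -/
  ring : ValuationSubring L
  algebraMap_mem : ∀ c : K, algebraMap K L c ∈ ring
  ne_top : ring ≠ ⊤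

namespace Place

variable {K L M : Type*} [Field K] [Field L] [Field M] [Algebra K L] [Algebra K M]

/-- `P.IsZero f`: the function `f` vanishes at `P`, i.e. lies in the maximal ideal of the local
ring at `P`. -/
def IsZero (P : Place K L) (f : L) : Prop := f ∈ P.ring.nonunits

/-- `P.IsPole f`: the function `f` is not regular at `P`. -/
def IsPole (P : Place K L) (f : L) : Prop := f ∉ P.ring

/-- A proper valuation ring does not contain a subfield over which the big field is algebraic. -/
theorem comap_ne_top (P : Place K L) (i : M →ₐ[K] L) (hi : i.toRingHom.IsIntegral) :
    P.ring.comap i.toRingHom ≠ ⊤ := by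
  intro h
  apply P.ne_top
  rw [eq_top_iff]
  intro f _
  have hM : ∀ c : M, i c ∈ P.ring := fun c => by
    have : c ∈ P.ring.comap i.toRingHom := h ▸ ValuationSubring.mem_top c
    simpa [ValuationSubring.mem_comap] using this
  obtain ⟨p, hp, hpf⟩ := hi f
  let j : M →+* P.ring := i.toRingHom.codRestrict P.ring.toSubring hM
  have hf : IsIntegral P.ring f := by
    refine ⟨p.map j, hp.map j, ?_⟩
    rw [Polynomial.eval₂_map]
    exact hpf
  obtain ⟨g, hg⟩ := IsIntegrallyClosed.isIntegral_iff.mp hf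
  rw [← hg]
  exact g.2

/-- The map on points induced by a finite morphism of curves. The morphism is given by its
comorphism `i : M → L` of function fields, and the local ring at the image of `P` is the preimage
of the local ring at `P`. -/
def image (i : M →ₐ[K] L) (hi : i.toRingHom.IsIntegral) (P : Place K L) : Place K M where
  ring := P.ring.comap i.toRingHom
  algebraMap_mem c := by
    simpa [ValuationSubring.mem_comap] using P.algebraMap_mem c
  ne_top := P.comap_ne_top i hi

/-- The homomorphism from the local ring at the image of `P` to the local ring at `P`. -/
def localHom (i : M →ₐ[K] L) (hi : i.toRingHom.IsIntegral) (P : Place K L) :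
    (P.image i hi).ring →+* P.ring :=
  i.toRingHom.restrict (P.image i hi).ring P.ring fun _ h => h

/-- The ramification index at `P` of the morphism of curves with comorphism `i`: the ramification
index of the maximal ideal of the local ring at `P` over the maximal ideal of the local ring at the
image of `P`, i.e. the order at `P` of a local parameter at the image of `P`. -/
def ramificationIndex (i : M →ₐ[K] L) (hi : i.toRingHom.IsIntegral) (P : Place K L) : ℕ :=
  letI : Algebra (P.image i hi).ring P.ring := (P.localHom i hi).toAlgebra
  Ideal.ramificationIdx' (IsLocalRing.maximalIdeal (P.image i hi).ring)
    (IsLocalRing.maximalIdeal P.ring)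

end Place

/-! ## Irreducibility of the two plane curves -/

theorem irreducible_Y_pow_sub {K : Type*} [Field K] {n : ℕ} (hn : n ≠ 0) {h : K[X]}
    (hh : h.coeff 0 ≠ 0) : Irreducible (X ^ n - C (X * h) : K[X][X]) := by
  have hmonic : (X ^ n - C (X * h) : K[X][X]).Monic := monic_X_pow_sub_C _ hn
  have hdeg : (X ^ n - C (X * h) : K[X][X]).natDegree = n := natDegree_X_pow_sub_C
  have hprime : (Ideal.span {(X : K[X])}).IsPrime :=
    (Ideal.span_singleton_prime X_ne_zero).mpr prime_X
  have hE : (X ^ n - C (X * h) : K[X][X]).IsEisensteinAt (Ideal.span {(X : K[X])}) := by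
    refine ⟨?_, ?_, ?_⟩
    · rw [hmonic.leadingCoeff]
      exact fun h1 => hprime.ne_top ((Ideal.eq_top_iff_one _).mpr h1)
    · intro k hk
      rw [hdeg] at hk
      rw [coeff_sub, coeff_X_pow, if_neg hk.ne, zero_sub, coeff_C]
      split_ifs
      · exact neg_mem (Ideal.mem_span_singleton.mpr (dvd_mul_right _ _))
      · simp
    · rw [coeff_sub, coeff_X_pow, if_neg hn.symm, zero_sub, coeff_C_zero, neg_mem_iff,
        Ideal.span_singleton_pow, Ideal.mem_span_singleton, pow_two]
      intro hd
      have := (mul_dvd_mul_iff_left (X_ne_zero (R := K))).mp hd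
      exact hh (X_dvd_iff.mp this)
  exact hE.irreducible hprime hmonic.isPrimitive (by rw [hdeg]; exact Nat.pos_of_ne_zero hn)

variable (K : Type*) [Field K] (q₀ m : ℕ)

/-- The polynomial `Y ^ (q₀ + 1) - (X ^ q₀ + X)`, in the variable `Y` over `K[X]`. -/
def hermitianPolynomial : K[X][X] := X ^ (q₀ + 1) - C (X ^ q₀ + X)

/-- The polynomial `Y ^ ((q₀ ^ 2 - 1) / m) - X * (X + 1) ^ (q₀ - 1)`, in the variable `Y` over
`K[X]`. -/
def quotientPolynomial : K[X][X] := X ^ ((q₀ ^ 2 - 1) / m) - C (X * (X + 1) ^ (q₀ - 1))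

variable [hq : Fact (IsPrimePow q₀)] [hm : Fact (m ∣ q₀ ^ 2 - 1)]

theorem exponent_ne_zero : (q₀ ^ 2 - 1) / m ≠ 0 := by
  have h2 : 2 ≤ q₀ := hq.out.two_le
  have hpos : 0 < q₀ ^ 2 - 1 := by
    have : 2 ^ 2 ≤ q₀ ^ 2 := Nat.pow_le_pow_left h2 2
    omega
  exact (Nat.div_pos (Nat.le_of_dvd hpos hm.out) (Nat.pos_of_dvd_of_pos hm.out hpos)).ne'

instance : Fact (Irreducible (hermitianPolynomial K q₀)) := by
  have h2 : 2 ≤ q₀ := hq.out.two_le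
  have h0 : q₀ - 1 ≠ 0 := by omega
  have key : (X ^ q₀ + X : K[X]) = X * (X ^ (q₀ - 1) + 1) := by
    rw [mul_add, mul_one, ← pow_succ', Nat.sub_add_cancel (by omega)]
  refine ⟨?_⟩
  rw [hermitianPolynomial, key]
  exact irreducible_Y_pow_sub (Nat.succ_ne_zero _) (by simp [coeff_X_pow, h0.symm])

instance : Fact (Irreducible (quotientPolynomial K q₀ m)) :=
  ⟨irreducible_Y_pow_sub (exponent_ne_zero q₀ m) (by simp [coeff_zero_eq_eval_zero])⟩

instance : IsDomain (AdjoinRoot (hermitianPolynomial K q₀)) :=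
  AdjoinRoot.isDomain_of_prime (Fact.out : Irreducible (hermitianPolynomial K q₀)).prime

instance : IsDomain (AdjoinRoot (quotientPolynomial K q₀ m)) :=
  AdjoinRoot.isDomain_of_prime (Fact.out : Irreducible (quotientPolynomial K q₀ m)).prime

/-! ## The two curves -/

/-- The function field over `K` of the Hermitian curve `Y ^ (q₀ + 1) = X ^ q₀ + X`. -/
abbrev HermitianField : Type _ := FractionRing (AdjoinRoot (hermitianPolynomial K q₀))

/-- The function field over `K` of the curve `Y ^ ((q₀ ^ 2 - 1) / m) = X * (X + 1) ^ (q₀ - 1)`. -/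
abbrev QuotientField : Type _ := FractionRing (AdjoinRoot (quotientPolynomial K q₀ m))

/-- The Hermitian curve: the nonsingular projective model of `Y ^ (q₀ + 1) = X ^ q₀ + X`. -/
abbrev HermitianCurve : Type _ := Place K (HermitianField K q₀)

/-- The nonsingular projective model of `Y ^ ((q₀ ^ 2 - 1) / m) = X * (X + 1) ^ (q₀ - 1)`. -/
abbrev QuotientCurve : Type _ := Place K (QuotientField K q₀ m)

/-- The coordinate function `x` on the Hermitian curve. -/
def x : HermitianField K q₀ :=
  algebraMap (AdjoinRoot (hermitianPolynomial K q₀)) _ (AdjoinRoot.of _ X)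

/-- The coordinate function `y` on the Hermitian curve. -/
def y : HermitianField K q₀ :=
  algebraMap (AdjoinRoot (hermitianPolynomial K q₀)) _ (AdjoinRoot.root _)

/-- The coordinate function `t` (the class of `X`) on the quotient curve. -/
def t : QuotientField K q₀ m :=
  algebraMap (AdjoinRoot (quotientPolynomial K q₀ m)) _ (AdjoinRoot.of _ X)

/-- The coordinate function `z` (the class of `Y`) on the quotient curve. -/
def z : QuotientField K q₀ m :=
  algebraMap (AdjoinRoot (quotientPolynomial K q₀ m)) _ (AdjoinRoot.root _)

/-- `P` is the point of the Hermitian curve with affine coordinates `(a, b)`. -/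
def HasCoords {K : Type*} [Field K] {q₀ : ℕ} [Fact (IsPrimePow q₀)] (P : HermitianCurve K q₀)
    (a b : K) : Prop :=
  P.IsZero (x K q₀ - algebraMap K _ a) ∧ P.IsZero (y K q₀ - algebraMap K _ b)

/-- `P` is a point at infinity of the Hermitian curve: one of the coordinate functions is not
regular at `P`. -/
def IsInfinite {K : Type*} [Field K] {q₀ : ℕ} [Fact (IsPrimePow q₀)] (P : HermitianCurve K q₀) :
    Prop :=
  P.IsPole (x K q₀) ∨ P.IsPole (y K q₀)

/-! ## The rational map `(x, y) ↦ (x ^ (q₀ - 1), y ^ m)` -/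

theorem hermitian_equation : y K q₀ ^ (q₀ + 1) = x K q₀ ^ q₀ + x K q₀ := by
  have h : AdjoinRoot.root (hermitianPolynomial K q₀) ^ (q₀ + 1)
      = AdjoinRoot.of (hermitianPolynomial K q₀) (X ^ q₀ + X) := by
    have h := AdjoinRoot.eval₂_root (hermitianPolynomial K q₀)
    conv at h => lhs; arg 3; rw [hermitianPolynomial]
    rwa [eval₂_sub, eval₂_X_pow, eval₂_C, sub_eq_zero] at h
  have h' := congrArg
    (algebraMap (AdjoinRoot (hermitianPolynomial K q₀)) (HermitianField K q₀)) h
  rw [map_add, map_pow] at h'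
  simpa only [x, y, map_pow, map_add] using h'

theorem quotient_equation :
    (y K q₀ ^ m) ^ ((q₀ ^ 2 - 1) / m)
      = x K q₀ ^ (q₀ - 1) * (x K q₀ ^ (q₀ - 1) + 1) ^ (q₀ - 1) := by
  have h2 : 2 ≤ q₀ := hq.out.two_le
  have hfac : q₀ ^ 2 - 1 = (q₀ + 1) * (q₀ - 1) := by
    simpa using Nat.sq_sub_sq q₀ 1
  have key : x K q₀ ^ q₀ + x K q₀ = x K q₀ * (x K q₀ ^ (q₀ - 1) + 1) := by
    rw [mul_add, mul_one, ← pow_succ', Nat.sub_add_cancel (by omega)]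
  rw [← pow_mul, Nat.mul_div_cancel' hm.out, hfac, pow_mul, hermitian_equation, key, mul_pow]

theorem transcendental_x : Transcendental K (x K q₀) := by
  have hinj : Function.Injective (AdjoinRoot.of (hermitianPolynomial K q₀)) := by
    refine AdjoinRoot.of.injective_of_degree_ne_zero ?_
    rw [hermitianPolynomial, degree_X_pow_sub_C (Nat.succ_pos _)]
    exact_mod_cast Nat.succ_ne_zero q₀
  have hcomp : Function.Injective ((algebraMap (AdjoinRoot (hermitianPolynomial K q₀))
      (HermitianField K q₀)).comp (AdjoinRoot.of (hermitianPolynomial K q₀))) :=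
    (IsFractionRing.injective (AdjoinRoot (hermitianPolynomial K q₀))
      (HermitianField K q₀)).comp hinj
  rw [transcendental_iff_injective]
  convert hcomp using 1
  have : (aeval (x K q₀) : K[X] →ₐ[K] HermitianField K q₀).toRingHom
      = (algebraMap (AdjoinRoot (hermitianPolynomial K q₀)) (HermitianField K q₀)).comp
          (AdjoinRoot.of (hermitianPolynomial K q₀)) := by
    refine Polynomial.ringHom_ext ?_ ?_
    · intro c
      simp [IsScalarTower.algebraMap_apply K (AdjoinRoot (hermitianPolynomial K q₀))
        (HermitianField K q₀)]
      rfl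
    · simp [x]
  exact congrArg DFunLike.coe this

/-- The comorphism on the coordinate ring. -/
def phiRing : AdjoinRoot (quotientPolynomial K q₀ m) →ₐ[K] HermitianField K q₀ :=
  AdjoinRoot.liftAlgHom (quotientPolynomial K q₀ m) (aeval (x K q₀ ^ (q₀ - 1))) (y K q₀ ^ m) (by
    rw [quotientPolynomial, eval₂_sub, eval₂_X_pow, eval₂_C, sub_eq_zero]
    simpa using quotient_equation K q₀ m)

theorem phiRing_of (p : K[X]) :
    phiRing K q₀ m (AdjoinRoot.of (quotientPolynomial K q₀ m) p)
      = aeval (x K q₀ ^ (q₀ - 1)) p := by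
  simp [phiRing]

theorem phiRing_root :
    phiRing K q₀ m (AdjoinRoot.root (quotientPolynomial K q₀ m)) = y K q₀ ^ m := by
  simp [phiRing]

theorem phiRing_injective : Function.Injective (phiRing K q₀ m) := by
  have h2 : 2 ≤ q₀ := hq.out.two_le
  have hmonic : (quotientPolynomial K q₀ m).Monic :=
    monic_X_pow_sub_C _ (exponent_ne_zero q₀ m)
  have hfin : Module.Finite K[X] (AdjoinRoot (quotientPolynomial K q₀ m)) :=
    hmonic.finite_adjoinRoot
  have hint : Algebra.IsIntegral K[X] (AdjoinRoot (quotientPolynomial K q₀ m)) :=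
    inferInstance
  have ht : Transcendental K (x K q₀ ^ (q₀ - 1)) :=
    (transcendental_x K q₀).pow (by omega)
  change Function.Injective (phiRing K q₀ m).toRingHom
  rw [RingHom.injective_iff_ker_eq_bot]
  refine Ideal.eq_bot_of_comap_eq_bot (R := K[X]) ?_
  rw [eq_bot_iff]
  intro p hp
  have hp' : phiRing K q₀ m (AdjoinRoot.of (quotientPolynomial K q₀ m) p) = 0 := hp
  rw [phiRing_of] at hp'
  exact (transcendental_iff.mp ht) p hp'

/-- The comorphism of `φ : (x, y) ↦ (x ^ (q₀ - 1), y ^ m)`: the embedding of function fields that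
sends `t` to `x ^ (q₀ - 1)` and `z` to `y ^ m`. -/
def phi : QuotientField K q₀ m →ₐ[K] HermitianField K q₀ :=
  IsFractionRing.liftAlgHom (phiRing_injective K q₀ m)

theorem phi_t : phi K q₀ m (t K q₀ m) = x K q₀ ^ (q₀ - 1) := by
  rw [phi, t, IsFractionRing.liftAlgHom_apply, IsFractionRing.lift_algebraMap]
  exact (phiRing_of K q₀ m X).trans (aeval_X _)

theorem phi_z : phi K q₀ m (z K q₀ m) = y K q₀ ^ m := by
  rw [phi, z, IsFractionRing.liftAlgHom_apply, IsFractionRing.lift_algebraMap]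
  exact phiRing_root K q₀ m

theorem phi_isIntegral : (phi K q₀ m).toRingHom.IsIntegral := by
  have h2 : 2 ≤ q₀ := hq.out.two_le
  have hm0 : 0 < m := by
    refine Nat.pos_of_dvd_of_pos hm.out ?_
    have : 2 ^ 2 ≤ q₀ ^ 2 := Nat.pow_le_pow_left h2 2
    omega
  let : Algebra (QuotientField K q₀ m) (HermitianField K q₀) :=
    (phi K q₀ m).toRingHom.toAlgebra
  have hmap : ∀ f, algebraMap (QuotientField K q₀ m) (HermitianField K q₀) f
      = phi K q₀ m f := fun _ => rfl
  have hx : IsIntegral (QuotientField K q₀ m) (x K q₀) := by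
    refine IsIntegral.of_pow (n := q₀ - 1) (by omega) ?_
    rw [← phi_t K q₀ m, ← hmap]
    exact isIntegral_algebraMap
  have hy : IsIntegral (QuotientField K q₀ m) (y K q₀) := by
    refine IsIntegral.of_pow hm0 ?_
    rw [← phi_z K q₀ m, ← hmap]
    exact isIntegral_algebraMap
  have hK : ∀ c : K, IsIntegral (QuotientField K q₀ m) (algebraMap K (HermitianField K q₀) c) :=
    fun c => by
      rw [← (phi K q₀ m).commutes c, ← hmap]
      exact isIntegral_algebraMap
  have hof : ∀ p : K[X], IsIntegral (QuotientField K q₀ m)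
      (algebraMap (AdjoinRoot (hermitianPolynomial K q₀)) (HermitianField K q₀)
        (AdjoinRoot.of _ p)) := by
    intro p
    induction p using Polynomial.induction_on' with
    | add p r hp hr => rw [map_add, map_add]; exact hp.add hr
    | monomial n c =>
      rw [← C_mul_X_pow_eq_monomial, map_mul, map_mul, map_pow, map_pow]
      exact (hK c).mul (hx.pow n)
  have hring : ∀ a : AdjoinRoot (hermitianPolynomial K q₀), IsIntegral (QuotientField K q₀ m)
      (algebraMap (AdjoinRoot (hermitianPolynomial K q₀)) (HermitianField K q₀) a) := by
    intro a
    induction a using AdjoinRoot.induction_on with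
    | ih p =>
      induction p using Polynomial.induction_on' with
      | add p r hp hr => rw [map_add, map_add]; exact hp.add hr
      | monomial n c =>
        rw [← C_mul_X_pow_eq_monomial, map_mul, map_mul, map_pow, map_pow]
        exact (hof c).mul (hy.pow n)
  intro f
  obtain ⟨a, b, _, rfl⟩ :=
    IsFractionRing.div_surjective (A := AdjoinRoot (hermitianPolynomial K q₀)) f
  change IsIntegral (QuotientField K q₀ m) _
  rw [div_eq_mul_inv]
  exact (hring a).mul (hring b).inv

/-- The ramification index `e_P` of `φ` at a point `P` of the Hermitian curve. -/
def ramIndex (P : HermitianCurve K q₀) : ℕ :=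
  P.ramificationIndex (phi K q₀ m) (phi_isIntegral K q₀ m)

end Hermitian

end

noncomputable section

namespace Hermitian

/-! ### Places of a function field: valuations, uniformizers, ramification. -/

namespace Place

variable {K L M : Type*} [Field K] [Field L] [Field M] [Algebra K L] [Algebra K M]

/-! The ramification index at `P` is read off from orders of vanishing: if `π` is a uniformizer at
`P`, if the order at `P` of every function pulled back along `φ` is divisible by `e`, and if some
pulled-back function has order exactly `e`, then `e_P = e` (`ramificationIndex_eq`).

Divisibility comes from symmetry. For `ζ ^ m = 1` the automorphism `(x, y) ↦ (ζ ^ (q₀ + 1) x, ζ y)`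
fixes every function pulled back along `φ`. If it also fixes `P` and multiplies `π` by a primitive
`n`-th root of unity, comparing leading coefficients of an invariant function shows that `n` divides
its order (`dvd_of_map_eq_self`). This applies with `n = m` at `(0, 0)` and at infinity, and with `n
= d` at `(a, 0)` with `a ^ (q₀ - 1) = -1`. Functions attaining the bound are `z` at `(0, 0)`, a
Bézout product of powers of `z` and `t + 1` at `(a, 0)`, `t ^ m / z ^ q₀` at infinity, and `z - b ^
m` (order one) at `(a, b)` with `b ≠ 0`.

The local input is that `y - b` is a uniformizer at `(a, b)`. By additivity of the `q₀`-power map,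
`y ^ (q₀ + 1) - b ^ (q₀ + 1) = (x - a) (1 + (x - a) ^ (q₀ - 1))`, and the last factor is a unit at
the point. The involution `(1 / x, y / x)` carries this to infinity, where `y / x` is a uniformizer.
-/

theorem isZero_iff_valuation_lt_one {P : Place K L} {f : L} :
    P.IsZero f ↔ P.ring.valuation f < 1 :=
  P.ring.mem_nonunits_iff

theorem isPole_iff_isZero_inv {P : Place K L} {f : L} (hf : f ≠ 0) :
    P.IsPole f ↔ P.IsZero f⁻¹ := by
  rw [IsZero, ValuationSubring.inv_mem_nonunits_iff, or_iff_right hf, IsPole]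

theorem mem_image_ring {i : M →ₐ[K] L} {hi : i.toRingHom.IsIntegral} {P : Place K L} {f : M} :
    f ∈ (P.image i hi).ring ↔ i f ∈ P.ring :=
  Iff.rfl

theorem isZero_image_iff {i : M →ₐ[K] L} {hi : i.toRingHom.IsIntegral} {P : Place K L} {f : M} :
    (P.image i hi).IsZero f ↔ P.IsZero (i f) := by
  rw [IsZero, IsZero, ValuationSubring.mem_nonunits_iff_or, ValuationSubring.mem_nonunits_iff_or,
    mem_image_ring, map_inv₀, map_eq_zero]

/-- Both comparisons say that `f / g` is regular. The two valuations have different value groups, so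
only comparisons can be transferred, not values. -/
theorem valuation_image_le_iff {i : M →ₐ[K] L} {hi : i.toRingHom.IsIntegral} {P : Place K L}
    {f g : M} : (P.image i hi).ring.valuation f ≤ (P.image i hi).ring.valuation g
      ↔ P.ring.valuation (i f) ≤ P.ring.valuation (i g) := by
  by_cases hg : g = 0
  · simp [hg]
  · rw [← div_le_one₀ (b := (P.image i hi).ring.valuation g) (zero_lt_iff.mpr (by simp [hg])),
      ← div_le_one₀ (b := P.ring.valuation (i g)) (zero_lt_iff.mpr (by simp [hg])),
      ← map_div₀, ← map_div₀, ← map_div₀,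
      ValuationSubring.valuation_le_one_iff, ValuationSubring.valuation_le_one_iff, mem_image_ring]

theorem valuation_algebraMap (P : Place K L) {c : K} (hc : c ≠ 0) :
    P.ring.valuation (algebraMap K L c) = 1 := by
  refine le_antisymm ((P.ring.valuation_le_one_iff _).mpr (P.algebraMap_mem c)) ?_
  have h := (P.ring.valuation_le_one_iff _).mpr (P.algebraMap_mem c⁻¹)
  rw [map_inv₀, map_inv₀] at h
  have h0 : P.ring.valuation (algebraMap K L c) ≠ 0 := by simpa using hc
  exact (inv_le_one₀ (zero_lt_iff.mpr h0)).mp h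

theorem isZero_algebraMap_iff {P : Place K L} {c : K} : P.IsZero (algebraMap K L c) ↔ c = 0 := by
  rw [isZero_iff_valuation_lt_one]
  refine ⟨fun h => ?_, fun h => by simp [h]⟩
  by_contra hc
  exact h.ne (P.valuation_algebraMap hc)

theorem IsZero.add {P : Place K L} {f g : L} (hf : P.IsZero f) (hg : P.IsZero g) :
    P.IsZero (f + g) :=
  add_mem (S := NonUnitalSubring L) hf hg

theorem IsZero.sub {P : Place K L} {f g : L} (hf : P.IsZero f) (hg : P.IsZero g) :
    P.IsZero (f - g) :=
  sub_mem (S := NonUnitalSubring L) hf hg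

theorem IsZero.mem {P : Place K L} {f : L} (hf : P.IsZero f) : f ∈ P.ring :=
  P.ring.nonunits_le hf

theorem IsZero.mul_right {P : Place K L} {f g : L} (hf : P.IsZero f) (hg : g ∈ P.ring) :
    P.IsZero (f * g) := by
  rw [isZero_iff_valuation_lt_one] at hf ⊢
  rw [map_mul]
  exact mul_lt_one_of_lt_of_le hf ((P.ring.valuation_le_one_iff _).mpr hg)

theorem mem_of_isZero_sub {P : Place K L} {f : L} {c : K} (h : P.IsZero (f - algebraMap K L c)) :
    f ∈ P.ring := by
  simpa using add_mem h.mem (P.algebraMap_mem c)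

/-- The function `π` is a uniformizer at the point `P`. -/
structure IsUniformizer (P : Place K L) (π : L) : Prop where
  ne_zero : π ≠ 0
  isZero : P.IsZero π
  exists_valuation_eq : ∀ f : L, f ≠ 0 → ∃ k : ℤ, P.ring.valuation f = P.ring.valuation π ^ k

namespace IsUniformizer

variable {P : Place K L} {π : L}

theorem valuation_pos (h : P.IsUniformizer π) : 0 < P.ring.valuation π :=
  zero_lt_iff.mpr (by simpa using h.ne_zero)

theorem valuation_lt_one (h : P.IsUniformizer π) : P.ring.valuation π < 1 :=
  isZero_iff_valuation_lt_one.mp h.isZero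

theorem zpow_le_zpow_iff (h : P.IsUniformizer π) {k l : ℤ} :
    P.ring.valuation π ^ k ≤ P.ring.valuation π ^ l ↔ l ≤ k :=
  zpow_le_zpow_iff_right_of_lt_one₀ h.valuation_pos h.valuation_lt_one

theorem zpow_lt_one_iff (h : P.IsUniformizer π) {k : ℤ} :
    P.ring.valuation π ^ k < 1 ↔ 0 < k :=
  zpow_lt_one_iff_right_of_lt_one₀ h.valuation_pos h.valuation_lt_one

/-- All nonzero values are integral powers of the value of `π`, so value less than `1` means
divisible by `π`: the maximal ideal is principal, generated by `π`. -/
theorem mem_maximalIdeal_pow_iff (h : P.IsUniformizer π) (n : ℕ) (f : P.ring) :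
    f ∈ IsLocalRing.maximalIdeal P.ring ^ n
      ↔ P.ring.valuation (f : L) ≤ P.ring.valuation π ^ n := by
  let ϖ : P.ring := ⟨π, h.isZero.mem⟩
  have hdvd : ∀ (k : ℕ) (g : P.ring), ϖ ^ k ∣ g
      ↔ P.ring.valuation (g : L) ≤ P.ring.valuation π ^ k := by
    intro k g
    rw [← map_pow, ValuationSubring.valuation_le_iff]
    constructor
    · rintro ⟨c, hc⟩
      exact ⟨c, by rw [hc]; push_cast; exact mul_comm _ _⟩
    · rintro ⟨c, hc⟩
      exact ⟨c, Subtype.ext (by push_cast; rw [← hc]; exact mul_comm _ _)⟩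
  have hspan : IsLocalRing.maximalIdeal P.ring = Ideal.span {ϖ} := by
    ext g
    rw [Ideal.mem_span_singleton, ← pow_one ϖ, hdvd, ValuationSubring.valuation_lt_one_iff]
    constructor
    · intro hg
      by_cases hg0 : (g : L) = 0
      · simp [hg0]
      · obtain ⟨k, hk⟩ := h.exists_valuation_eq g hg0
        rw [hk, h.zpow_lt_one_iff] at hg
        rw [hk, ← zpow_natCast, h.zpow_le_zpow_iff]
        exact_mod_cast hg
    · intro hg
      exact lt_of_le_of_lt hg (by simpa using h.valuation_lt_one)
  rw [hspan, Ideal.span_singleton_pow, Ideal.mem_span_singleton, hdvd]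

/-- If all functions coming from the target have order divisible by `e`, and one of them has order
`e`, then `e` is the ramification index. -/
theorem ramificationIndex_eq (h : P.IsUniformizer π) (i : M →ₐ[K] L)
    (hi : i.toRingHom.IsIntegral) {e : ℕ} (he : 0 < e)
    (hdvd : ∀ (f : M) (k : ℤ), P.ring.valuation (i f) = P.ring.valuation π ^ k → (e : ℤ) ∣ k)
    {g : M} (hg : P.ring.valuation (i g) = P.ring.valuation π ^ e) :
    P.ramificationIndex i hi = e := by
  let : Algebra (P.image i hi).ring P.ring := (P.localHom i hi).toAlgebra
  have hmap : ∀ f : (P.image i hi).ring,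
      ((algebraMap (P.image i hi).ring P.ring f : P.ring) : L) = i f := fun _ => rfl
  have hmax : ∀ f : (P.image i hi).ring,
      f ∈ IsLocalRing.maximalIdeal (P.image i hi).ring ↔ P.ring.valuation (i f) < 1 := fun f => by
    rw [← isZero_iff_valuation_lt_one, ← isZero_image_iff (hi := hi)]
    exact (ValuationSubring.coe_mem_nonunits_iff).symm
  change Ideal.ramificationIdx' (IsLocalRing.maximalIdeal (P.image i hi).ring)
    (IsLocalRing.maximalIdeal P.ring) = e
  apply Ideal.ramificationIdx'_spec
  · rw [Ideal.map_le_iff_le_comap]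
    intro f hf
    rw [Ideal.mem_comap, h.mem_maximalIdeal_pow_iff, hmap]
    rw [hmax] at hf
    by_cases hf0 : i f = 0
    · simp [hf0]
    -- A positive order divisible by `e` is at least `e`.
    · obtain ⟨k, hk⟩ := h.exists_valuation_eq _ hf0
      rw [hk, h.zpow_lt_one_iff] at hf
      rw [hk, ← zpow_natCast, h.zpow_le_zpow_iff]
      exact Int.le_of_dvd hf (hdvd f k hk)
  -- The function `g` has order exactly `e`, so it is not in the power `e + 1`.
  · intro hle
    have hlt : P.ring.valuation (i g) < 1 := by
      rw [hg, ← zpow_natCast, h.zpow_lt_one_iff]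
      exact_mod_cast he
    have hgmem : g ∈ (P.image i hi).ring := (P.ring.valuation_le_one_iff _).mp hlt.le
    have := hle (Ideal.mem_map_of_mem _ ((hmax ⟨g, hgmem⟩).mpr hlt))
    rw [h.mem_maximalIdeal_pow_iff, hmap, hg, ← zpow_natCast, ← zpow_natCast,
      h.zpow_le_zpow_iff] at this
    push_cast at this
    omega

/-- A function that is fixed by an automorphism of order `n` which fixes the point `P` and acts
on a uniformizer at `P` by a primitive `n`-th root of unity has order divisible by `n` at `P`. -/
theorem dvd_of_map_eq_self (h : P.IsUniformizer π)
    (hres : ∀ u : L, P.ring.valuation u = 1 → ∃ c : K, P.IsZero (u - algebraMap K L c))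
    {σ : L →ₐ[K] L} {hσ : σ.toRingHom.IsIntegral} (hP : P.image σ hσ = P) {n : ℕ} {ζ : K}
    (hζ : IsPrimitiveRoot ζ n) (hn : n ≠ 0) (hπ : σ π = algebraMap K L ζ * π) {f : L}
    (hf : σ f = f) {k : ℤ} (hk : P.ring.valuation f = P.ring.valuation π ^ k) : (n : ℤ) ∣ k := by
  have hζ0 : ζ ≠ 0 := hζ.ne_zero hn
  have hπk : π ^ k ≠ 0 := zpow_ne_zero k h.ne_zero
  -- The unit `f / π ^ k` has a nonzero residue `c`. As `σ` fixes `P` and the constants, `σ (f / π ^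
  -- k) = ζ ^ (-k) * (f / π ^ k)` has the same residue, whence `c = c * ζ ^ k`.
  obtain ⟨c, hc⟩ := hres (f / π ^ k) (by
    rw [map_div₀, map_zpow₀, hk, div_self]
    exact zpow_ne_zero k h.valuation_pos.ne')
  have hc0 : c ≠ 0 := by
    rintro rfl
    rw [map_zero, sub_zero, isZero_iff_valuation_lt_one, map_div₀, map_zpow₀, hk, div_self] at hc
    · exact lt_irrefl _ hc
    · exact zpow_ne_zero k h.valuation_pos.ne'
  have h1 : P.IsZero (σ (f / π ^ k) - algebraMap K L c) := by
    rw [← hP, isZero_image_iff] at hc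
    simpa using hc
  have h2 : σ (f / π ^ k) * algebraMap K L (ζ ^ k) = f / π ^ k := by
    have : algebraMap K L ζ ^ k ≠ 0 := zpow_ne_zero k (by simpa using hζ0)
    rw [map_div₀, map_zpow₀, hf, hπ, mul_zpow, map_zpow₀]
    field_simp
  have h3 := (h1.mul_right (P.algebraMap_mem (ζ ^ k))).sub hc
  rw [sub_mul, h2] at h3
  have h4 : P.IsZero (algebraMap K L (c - c * ζ ^ k)) := by
    rw [map_sub, map_mul]
    convert h3 using 1
    ring
  rw [isZero_algebraMap_iff, sub_eq_zero] at h4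
  exact (hζ.zpow_eq_one_iff_dvd k).mp (mul_left_cancel₀ hc0 (by rw [← h4, mul_one]))

/-- For an involution, the order of `f` at the image point is the order of `σ f` at `P`. This later
carries the uniformizer `y` at `(0, 0)` to `y / x` at infinity. -/
theorem of_image {σ : L →ₐ[K] L} {hσ : σ.toRingHom.IsIntegral} (hinv : ∀ f, σ (σ f) = f)
    (h : P.IsUniformizer π) : (P.image σ hσ).IsUniformizer (σ π) := by
  refine ⟨by simpa using h.ne_zero, by rw [isZero_image_iff, hinv]; exact h.isZero, ?_⟩
  intro f hf
  obtain ⟨k, hk⟩ := h.exists_valuation_eq (σ f) (by simpa using hf)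
  refine ⟨k, ?_⟩
  rw [← map_zpow₀] at hk ⊢
  apply le_antisymm <;> rw [valuation_image_le_iff, map_zpow₀, hinv, hk]

end IsUniformizer

end Place

end Hermitian

/-! ### The local ring at an affine point of the Hermitian curve. -/

namespace Hermitian

open Place

variable {K : Type*} [Field K] {q₀ : ℕ}

/-- Evaluation of regular functions at the affine point `(a, b)` of the Hermitian curve. -/
def evalAt (a b : K) (hab : b ^ (q₀ + 1) = a ^ q₀ + a) :
    AdjoinRoot (hermitianPolynomial K q₀) →ₐ[K] K :=
  AdjoinRoot.liftAlgHom _ (aeval a) b (by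
    rw [hermitianPolynomial, eval₂_sub, eval₂_X_pow, eval₂_C, sub_eq_zero]
    simpa using hab)

section evalAt

variable {a b : K} (hab : b ^ (q₀ + 1) = a ^ q₀ + a)

theorem evalAt_of (p : K[X]) : evalAt a b hab (AdjoinRoot.of _ p) = p.eval a := by
  simp [evalAt]

theorem evalAt_root : evalAt a b hab (AdjoinRoot.root _) = b := by
  simp [evalAt]

theorem of_C (c : K) : AdjoinRoot.of (hermitianPolynomial K q₀) (C c) = algebraMap K _ c :=
  rfl

/-- The maximal ideal of the point `(a, b)` is generated by `x - a` and `y - b`. -/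
theorem exists_eq_of_evalAt_eq_zero {g : AdjoinRoot (hermitianPolynomial K q₀)}
    (hg : evalAt a b hab g = 0) :
    ∃ g₁ g₂, g = (AdjoinRoot.of _ X - algebraMap K _ a) * g₁
      + (AdjoinRoot.root _ - algebraMap K _ b) * g₂ := by
  obtain ⟨p, rfl⟩ := AdjoinRoot.mk_surjective g
  -- Divide by `Y - b`, then divide the remainder, a polynomial in `X`, by `X - a`; what is left is
  -- the value at the point.
  obtain ⟨r, hr⟩ := X_sub_C_dvd_sub_C_eval (p := p) (a := C b)
  obtain ⟨s, hs⟩ := X_sub_C_dvd_sub_C_eval (p := p.eval (C b)) (a := a)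
  rw [sub_eq_iff_eq_add] at hr hs
  have hp : AdjoinRoot.mk (hermitianPolynomial K q₀) p
      = (AdjoinRoot.root _ - algebraMap K _ b) * AdjoinRoot.mk _ r
        + ((AdjoinRoot.of _ X - algebraMap K _ a) * AdjoinRoot.of _ s
          + algebraMap K _ ((p.eval (C b)).eval a)) := by
    conv_lhs => rw [hr, hs]
    simp [of_C]
  rw [hp] at hg ⊢
  have : (p.eval (C b)).eval a = 0 := by
    simpa [evalAt_of, evalAt_root] using hg
  exact ⟨AdjoinRoot.of _ s, AdjoinRoot.mk _ r, by rw [this]; simp; ring⟩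

end evalAt

variable [hq : Fact (IsPrimePow q₀)]

theorem of_pow_add_of :
    AdjoinRoot.root (hermitianPolynomial K q₀) ^ (q₀ + 1)
      = AdjoinRoot.of (hermitianPolynomial K q₀) X ^ q₀ + AdjoinRoot.of _ X := by
  apply IsFractionRing.injective (AdjoinRoot (hermitianPolynomial K q₀)) (HermitianField K q₀)
  simpa [x, y] using hermitian_equation K q₀

theorem root_sub_ne_zero (b : K) :
    AdjoinRoot.root (hermitianPolynomial K q₀) - algebraMap K _ b ≠ 0 := by
  have h2 : 2 ≤ q₀ := hq.out.two_le
  have hmonic : (hermitianPolynomial K q₀).Monic := monic_X_pow_sub_C _ (Nat.succ_ne_zero _)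
  have := AdjoinRoot.mk_ne_zero_of_natDegree_lt hmonic (X_sub_C_ne_zero (C b)) (by
    rw [natDegree_X_sub_C, hermitianPolynomial, natDegree_X_pow_sub_C]
    omega)
  simpa [of_C] using this

theorem y_sub_ne_zero (b : K) : y K q₀ - algebraMap K _ b ≠ 0 := by
  have := root_sub_ne_zero (q₀ := q₀) b
  rw [← (IsFractionRing.injective (AdjoinRoot (hermitianPolynomial K q₀))
    (HermitianField K q₀)).ne_iff, map_sub, map_zero, ← IsScalarTower.algebraMap_apply] at this
  exact this

variable {p k : ℕ} [Fact p.Prime] [CharP K p]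

/-- Up to a factor that does not vanish at `(a, b)`, the function `x - a` is a multiple of
`y - b`. -/
theorem dvd_mul_sub (hqp : q₀ = p ^ k) {a b : K} (hab : b ^ (q₀ + 1) = a ^ q₀ + a) :
    (AdjoinRoot.root (hermitianPolynomial K q₀) - algebraMap K _ b)
      ∣ (1 + (AdjoinRoot.of _ X - algebraMap K _ a) ^ (q₀ - 1))
        * (AdjoinRoot.of _ X - algebraMap K _ a) := by
  have : CharP (AdjoinRoot (hermitianPolynomial K q₀)) p :=
    charP_of_injective_algebraMap (algebraMap K _).injective p
  have h2 : 2 ≤ q₀ := hq.out.two_le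
  -- Since `q₀` is a power of the characteristic, `x ^ q₀ - a ^ q₀ = (x - a) ^ q₀`.
  have h : (AdjoinRoot.root (hermitianPolynomial K q₀)) ^ (q₀ + 1) - algebraMap K _ b ^ (q₀ + 1)
      = (1 + (AdjoinRoot.of _ X - algebraMap K _ a) ^ (q₀ - 1))
        * (AdjoinRoot.of _ X - algebraMap K _ a) := by
    rw [add_mul, one_mul, ← pow_succ, Nat.sub_add_cancel (by omega), of_pow_add_of,
      ← map_pow (algebraMap K _), hab, map_add, map_pow (algebraMap K _)]
    have hfrob := sub_pow_char_pow (n := k)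
      (AdjoinRoot.of (hermitianPolynomial K q₀) X) (algebraMap K _ a)
    simp only [← hqp] at hfrob
    rw [hfrob]
    ring
  rw [← h]
  exact sub_dvd_pow_sub_pow _ _ _

/-- Every nonzero function is a power of `y - b` times a function that is regular and does not
vanish at `(a, b)`. -/
theorem exists_mul_eq_pow_mul (hqp : q₀ = p ^ k) {a b : K} (hab : b ^ (q₀ + 1) = a ^ q₀ + a)
    {g : AdjoinRoot (hermitianPolynomial K q₀)} (hg : g ≠ 0) :
    ∃ (n : ℕ) (r s : AdjoinRoot (hermitianPolynomial K q₀)), evalAt a b hab r ≠ 0 ∧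
      evalAt a b hab s ≠ 0 ∧ s * g = (AdjoinRoot.root _ - algebraMap K _ b) ^ n * r := by
  have h2 : 2 ≤ q₀ := hq.out.two_le
  let A := AdjoinRoot (hermitianPolynomial K q₀)
  let 𝔪 : Ideal A := RingHom.ker (evalAt a b hab)
  have hprime : 𝔪.IsPrime := RingHom.ker_isPrime _
  let B := Localization.AtPrime 𝔪
  let π : A := AdjoinRoot.root _ - algebraMap K _ b
  have hπ0 : π ≠ 0 := root_sub_ne_zero b
  have hinj : Function.Injective (algebraMap A B) :=
    IsLocalization.injective B 𝔪.primeCompl_le_nonZeroDivisors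
  have hnoeth : IsNoetherianRing A := inferInstance
  have hnoethB : IsNoetherianRing B := IsLocalization.isNoetherianRing 𝔪.primeCompl B hnoeth
  -- The maximal ideal is generated by `x - a` and `y - b`. The factor `1 + (x - a) ^ (q₀ - 1)` has
  -- value `1` at the point, so it is a unit and `x - a` is redundant.
  have hmax : IsLocalRing.maximalIdeal B = Ideal.span {algebraMap A B π} := by
    rw [← Localization.AtPrime.map_eq_maximalIdeal]
    apply le_antisymm
    · rw [Ideal.map_le_iff_le_comap]
      intro g hg
      obtain ⟨g₁, g₂, rfl⟩ := exists_eq_of_evalAt_eq_zero hab hg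
      have hunit : IsUnit (algebraMap A B
          (1 + (AdjoinRoot.of _ X - algebraMap K _ a) ^ (q₀ - 1))) := by
        refine IsLocalization.map_units B (M := 𝔪.primeCompl) ⟨_, fun h => ?_⟩
        have h' : evalAt a b hab (1 + (AdjoinRoot.of _ X - algebraMap K _ a) ^ (q₀ - 1)) = 0 := h
        simp [evalAt_of, show q₀ - 1 ≠ 0 by omega] at h'
      have hdvd := map_dvd (algebraMap A B) (dvd_mul_sub hqp hab)
      rw [map_mul, hunit.dvd_mul_left] at hdvd
      rw [Ideal.mem_comap, Ideal.mem_span_singleton, map_add, map_mul, map_mul]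
      exact dvd_add (hdvd.mul_right _) (dvd_mul_right _ _)
    · rw [Ideal.span_singleton_le_iff_mem]
      refine Ideal.mem_map_of_mem _ ?_
      change evalAt a b hab π = 0
      simp [π, evalAt_root]
  have hfield : ¬ IsField B := by
    rw [IsLocalRing.isField_iff_maximalIdeal_eq, hmax, Ideal.span_singleton_eq_bot]
    exact fun h => hπ0 (hinj (by rw [h, map_zero]))
  -- A Noetherian local domain, not a field, with principal maximal ideal.
  have hdvr : IsDiscreteValuationRing B :=
    ((IsDiscreteValuationRing.TFAE B hfield).out 0 4 rfl rfl).mpr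
      (show Submodule.IsPrincipal _ from ⟨⟨_, hmax⟩⟩)
  have hirr : Irreducible (algebraMap A B π) :=
    (IsDiscreteValuationRing.irreducible_iff_uniformizer _).mpr hmax
  obtain ⟨n, u, hu⟩ := IsDiscreteValuationRing.eq_unit_mul_pow_irreducible
    (x := algebraMap A B g) (fun h => hg (hinj (by rw [h, map_zero]))) hirr
  obtain ⟨r, s, hrs⟩ := IsLocalization.exists_mk'_eq 𝔪.primeCompl (u : B)
  refine ⟨n, r, s, ?_, s.2, ?_⟩
  · have := u.isUnit
    rw [← hrs, IsLocalization.AtPrime.isUnit_mk'_iff B 𝔪] at this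
    exact this
  · apply hinj
    rw [map_mul, hu, ← hrs, map_mul, map_pow, ← mul_assoc, IsLocalization.mk'_spec', mul_comm]

/-- Take the quotient of two factorizations from the coordinate ring. No place occurs in the
statement, so it serves both to construct the place at `(a, b)` and to compute in any place with
these coordinates. -/
theorem exists_eq_zpow_mul (hqp : q₀ = p ^ k) {a b : K} (hab : b ^ (q₀ + 1) = a ^ q₀ + a)
    {f : HermitianField K q₀} (hf : f ≠ 0) :
    ∃ (n : ℤ) (r s : AdjoinRoot (hermitianPolynomial K q₀)), evalAt a b hab r ≠ 0 ∧
      evalAt a b hab s ≠ 0 ∧ f = (y K q₀ - algebraMap K _ b) ^ n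
        * (algebraMap _ (HermitianField K q₀) r / algebraMap _ (HermitianField K q₀) s) := by
  obtain ⟨g, h, hh, rfl⟩ :=
    IsFractionRing.div_surjective (A := AdjoinRoot (hermitianPolynomial K q₀)) f
  have hh0 : h ≠ 0 := nonZeroDivisors.ne_zero hh
  have hg0 : g ≠ 0 := by
    rintro rfl
    simp at hf
  obtain ⟨n, r, s, hr, hs, hg⟩ := exists_mul_eq_pow_mul hqp hab hg0
  obtain ⟨n', r', s', hr', hs', hh'⟩ := exists_mul_eq_pow_mul hqp hab hh0
  have hne : ∀ w : AdjoinRoot (hermitianPolynomial K q₀), evalAt a b hab w ≠ 0 →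
      algebraMap _ (HermitianField K q₀) w ≠ 0 := by
    intro w hw
    rw [Ne, FaithfulSMul.algebraMap_eq_zero_iff]
    rintro rfl
    simp at hw
  have hπ : algebraMap (AdjoinRoot (hermitianPolynomial K q₀)) (HermitianField K q₀)
      (AdjoinRoot.root _ - algebraMap K _ b) = y K q₀ - algebraMap K _ b := by
    rw [map_sub, y, ← IsScalarTower.algebraMap_apply]
  have hg := congrArg (algebraMap _ (HermitianField K q₀)) hg
  have hh' := congrArg (algebraMap _ (HermitianField K q₀)) hh'
  rw [map_mul, map_mul, map_pow, hπ] at hg hh'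
  have hπ0 := y_sub_ne_zero (q₀ := q₀) b
  have h1 := hne _ hs
  have h2 := hne _ hr'
  have h3 := hne _ hs'
  rw [mul_comm, ← eq_div_iff h1] at hg
  rw [mul_comm, ← eq_div_iff h3] at hh'
  refine ⟨n - n', r * s', s * r', ?_, ?_, ?_⟩
  · rw [map_mul]; exact mul_ne_zero hr hs'
  · rw [map_mul]; exact mul_ne_zero hs hr'
  · rw [hg, hh', zpow_sub₀ hπ0, zpow_natCast, zpow_natCast, map_mul, map_mul]
    field_simp

end Hermitian

/-! ### Affine points: coordinates, uniqueness, existence. -/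

namespace Hermitian

theorem Place.IsZero.pow_sub_pow {K L : Type*} [Field K] [Field L] [Algebra K L] {P : Place K L}
    {f : L} {c : K} (h : P.IsZero (f - algebraMap K L c)) (n : ℕ) :
    P.IsZero (f ^ n - algebraMap K L (c ^ n)) := by
  induction n with
  | zero => simpa using (isZero_algebraMap_iff (P := P) (c := 0)).mpr rfl
  | succ n ih =>
    have := (h.mul_right (pow_mem (mem_of_isZero_sub h) n)).add
      (ih.mul_right (P.algebraMap_mem c))
    convert this using 1
    rw [pow_succ, pow_succ, map_mul]
    ring

/-- A function that satisfies a polynomial equation with constant coefficients modulo the maximal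
ideal takes a value in the algebraically closed constant field. -/
theorem Place.exists_isZero_sub_of_aeval {K L : Type*} [Field K] [IsAlgClosed K] [Field L]
    [Algebra K L] {P : Place K L} {f : L} (hf : f ∈ P.ring) {p : K[X]} (hp : p ≠ 0)
    (h : P.IsZero (aeval f p)) : ∃ a : K, P.IsZero (f - algebraMap K L a) := by
  by_contra! hne
  have hval : ∀ a : K, P.ring.valuation (f - algebraMap K L a) = 1 := fun a =>
    le_antisymm ((P.ring.valuation_le_one_iff _).mpr (sub_mem hf (P.algebraMap_mem a)))
      (not_lt.mp fun h => hne a (isZero_iff_valuation_lt_one.mpr h))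
  -- Otherwise `aeval f p` is a product of a nonzero constant and factors `f - a`, all of value `1`.
  have hsplit := (IsAlgClosed.splits p).eq_prod_roots
  rw [isZero_iff_valuation_lt_one, hsplit, map_mul, map_mul, aeval_C,
    P.valuation_algebraMap (leadingCoeff_ne_zero.mpr hp), one_mul, map_multiset_prod,
    map_multiset_prod, Multiset.map_map, Multiset.map_map] at h
  refine h.ne (Multiset.prod_eq_one fun w hw => ?_)
  obtain ⟨a, -, rfl⟩ := Multiset.mem_map.mp hw
  simpa using hval a

open Place

variable {K : Type*} [Field K] {q₀ : ℕ} [hq : Fact (IsPrimePow q₀)]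

theorem algebraMap_mem_ring {P : HermitianCurve K q₀} (hx : x K q₀ ∈ P.ring)
    (hy : y K q₀ ∈ P.ring) (g : AdjoinRoot (hermitianPolynomial K q₀)) :
    algebraMap _ (HermitianField K q₀) g ∈ P.ring := by
  have hof : ∀ r : K[X], algebraMap _ (HermitianField K q₀)
      (AdjoinRoot.of (hermitianPolynomial K q₀) r) ∈ P.ring := by
    intro r
    induction r using Polynomial.induction_on' with
    | add r s hr hs => rw [map_add, map_add]; exact add_mem hr hs
    | monomial n c =>
      rw [← C_mul_X_pow_eq_monomial, map_mul, map_mul, map_pow, map_pow]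
      exact mul_mem (P.algebraMap_mem c) (pow_mem hx n)
  induction g using AdjoinRoot.induction_on with
  | ih r =>
    induction r using Polynomial.induction_on' with
    | add r s hr hs => rw [map_add, map_add]; exact add_mem hr hs
    | monomial n c =>
      rw [← C_mul_X_pow_eq_monomial, map_mul, map_mul, map_pow, map_pow]
      exact mul_mem (hof c) (pow_mem hy n)

namespace HasCoords

variable {P Q : HermitianCurve K q₀} {a b : K}

theorem equation (h : HasCoords P a b) : b ^ (q₀ + 1) = a ^ q₀ + a := by
  have := ((h.1.pow_sub_pow q₀).add h.1).sub (h.2.pow_sub_pow (q₀ + 1))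
  rw [hermitian_equation] at this
  rw [← sub_eq_zero, ← isZero_algebraMap_iff (P := P)]
  convert this using 1
  simp only [map_sub, map_add]
  ring

theorem ext_left {a' b' : K} (h : HasCoords P a b) (h' : HasCoords P a' b') : a = a' := by
  have := h'.1.sub h.1
  rw [sub_sub_sub_cancel_left, ← map_sub, isZero_algebraMap_iff, sub_eq_zero] at this
  exact this

/-- Subtracting the value leaves an element of the ideal generated by `x - a` and `y - b`. -/
theorem isZero_algebraMap_sub (h : HasCoords P a b)
    (g : AdjoinRoot (hermitianPolynomial K q₀)) :
    P.IsZero (algebraMap _ (HermitianField K q₀) g - algebraMap K _ (evalAt a b h.equation g)) := by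
  obtain ⟨g₁, g₂, hg⟩ := exists_eq_of_evalAt_eq_zero h.equation
    (g := g - algebraMap K _ (evalAt a b h.equation g)) (by simp)
  have hg := congrArg (algebraMap _ (HermitianField K q₀)) hg
  rw [map_sub, ← IsScalarTower.algebraMap_apply] at hg
  rw [hg, map_add, map_mul, map_mul, map_sub, map_sub, ← IsScalarTower.algebraMap_apply,
    ← IsScalarTower.algebraMap_apply]
  have hmem := algebraMap_mem_ring (mem_of_isZero_sub h.1) (mem_of_isZero_sub h.2)
  exact (h.1.mul_right (hmem g₁)).add (h.2.mul_right (hmem g₂))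

theorem valuation_eq_one (h : HasCoords P a b) {g : AdjoinRoot (hermitianPolynomial K q₀)}
    (hg : evalAt a b h.equation g ≠ 0) :
    P.ring.valuation (algebraMap _ (HermitianField K q₀) g) = 1 := by
  have hmem := algebraMap_mem_ring (mem_of_isZero_sub h.1) (mem_of_isZero_sub h.2) g
  refine le_antisymm ((P.ring.valuation_le_one_iff _).mpr hmem) (not_lt.mp fun hlt => hg ?_)
  have := (isZero_iff_valuation_lt_one.mpr hlt).sub (h.isZero_algebraMap_sub g)
  rwa [sub_sub_cancel, isZero_algebraMap_iff] at this

variable {p k : ℕ} [Fact p.Prime] [CharP K p]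

theorem isUniformizer (hqp : q₀ = p ^ k) (h : HasCoords P a b) :
    P.IsUniformizer (y K q₀ - algebraMap K _ b) := by
  refine ⟨y_sub_ne_zero b, h.2, fun f hf => ?_⟩
  obtain ⟨n, r, s, hr, hs, hf⟩ := exists_eq_zpow_mul hqp h.equation hf
  refine ⟨n, ?_⟩
  rw [hf, map_mul, map_div₀, h.valuation_eq_one hr, h.valuation_eq_one hs, div_one, mul_one,
    map_zpow₀]

/-- A unit has the form `r / s` with `r` and `s` nonvanishing at the point, and its residue is the
quotient of their values. So the residue field is `K`, even without algebraic closedness. -/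
theorem exists_isZero_sub (hqp : q₀ = p ^ k) (h : HasCoords P a b) {u : HermitianField K q₀}
    (hu : P.ring.valuation u = 1) : ∃ c : K, P.IsZero (u - algebraMap K _ c) := by
  obtain ⟨n, r, s, hr, hs, rfl⟩ := exists_eq_zpow_mul hqp h.equation (f := u) (by
    rintro rfl
    simp at hu)
  have hs1 := h.valuation_eq_one hs
  rw [map_mul, map_div₀, h.valuation_eq_one hr, hs1, div_one, mul_one, map_zpow₀] at hu
  have hn : n = 0 := by
    have hπ := h.isUniformizer hqp
    have h1 := hπ.zpow_le_zpow_iff (k := n) (l := 0)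
    have h2 := hπ.zpow_le_zpow_iff (k := 0) (l := n)
    rw [hu, zpow_zero] at h1 h2
    exact le_antisymm (h2.mp le_rfl) (h1.mp le_rfl)
  subst hn
  refine ⟨evalAt a b h.equation r / evalAt a b h.equation s, ?_⟩
  set c := evalAt a b h.equation r / evalAt a b h.equation s with hc
  have hzero := h.isZero_algebraMap_sub (r - algebraMap K _ c * s)
  have hev : evalAt a b h.equation (r - algebraMap K _ c * s) = 0 := by
    rw [map_sub, map_mul, AlgHom.commutes, hc, Algebra.algebraMap_self_apply,
      div_mul_cancel₀ _ hs, sub_self]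
  have hs0 : algebraMap _ (HermitianField K q₀) s ≠ 0 := by
    intro h0
    simp [h0] at hs1
  have := hzero.mul_right (g := (algebraMap _ (HermitianField K q₀) s)⁻¹) (by
    rw [← ValuationSubring.valuation_le_one_iff, map_inv₀, hs1, inv_one])
  convert this using 1
  rw [hev, map_zero, sub_zero, map_sub, map_mul, ← IsScalarTower.algebraMap_apply]
  field_simp

theorem mem_ring_iff (hqp : q₀ = p ^ k) (h : HasCoords P a b) {n : ℤ}
    {r s : AdjoinRoot (hermitianPolynomial K q₀)} (hr : evalAt a b h.equation r ≠ 0)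
    (hs : evalAt a b h.equation s ≠ 0) :
    (y K q₀ - algebraMap K _ b) ^ n
        * (algebraMap _ (HermitianField K q₀) r / algebraMap _ (HermitianField K q₀) s) ∈ P.ring
      ↔ 0 ≤ n := by
  rw [← ValuationSubring.valuation_le_one_iff, map_mul, map_div₀, h.valuation_eq_one hr,
    h.valuation_eq_one hs, div_one, mul_one, map_zpow₀,
    ← (h.isUniformizer hqp).zpow_le_zpow_iff, zpow_zero]

/-- The factorization of `f` does not depend on the place, and regularity is decided by the sign of
the exponent. -/
theorem unique (hqp : q₀ = p ^ k) (hP : HasCoords P a b) (hQ : HasCoords Q a b) : P = Q := by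
  apply Place.ext
  ext f
  by_cases hf : f = 0
  · simp [hf, zero_mem]
  · obtain ⟨n, r, s, hr, hs, rfl⟩ := exists_eq_zpow_mul hqp hP.equation hf
    rw [hP.mem_ring_iff hqp hr hs, hQ.mem_ring_iff hqp hr hs]

end HasCoords

/-- Every solution of the equation of the Hermitian curve belongs to a point. -/
theorem exists_hasCoords {p k : ℕ} [Fact p.Prime] [CharP K p] (hqp : q₀ = p ^ k) {a b : K}
    (hab : b ^ (q₀ + 1) = a ^ q₀ + a) : ∃ P : HermitianCurve K q₀, HasCoords P a b := by
  let A := AdjoinRoot (hermitianPolynomial K q₀)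
  let ι : A →+* HermitianField K q₀ := algebraMap A (HermitianField K q₀)
  have hne : ∀ w : A, evalAt a b hab w ≠ 0 → ι w ≠ 0 := by
    intro w hw
    rw [Ne, FaithfulSMul.algebraMap_eq_zero_iff]
    rintro rfl
    simp at hw
  -- The localization of the coordinate ring at the kernel of evaluation, inside the function field.
  let R : Subring (HermitianField K q₀) :=
    { carrier := {f | ∃ r s : A, evalAt a b hab s ≠ 0 ∧ f = ι r / ι s}
      mul_mem' := by
        rintro _ _ ⟨r, s, hs, rfl⟩ ⟨r', s', hs', rfl⟩
        exact ⟨r * r', s * s', by rw [map_mul]; exact mul_ne_zero hs hs', by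
          rw [map_mul, map_mul, div_mul_div_comm]⟩
      one_mem' := ⟨1, 1, by simp, by simp⟩
      add_mem' := by
        rintro _ _ ⟨r, s, hs, rfl⟩ ⟨r', s', hs', rfl⟩
        exact ⟨r * s' + s * r', s * s', by rw [map_mul]; exact mul_ne_zero hs hs', by
          rw [div_add_div _ _ (hne _ hs) (hne _ hs'), map_add, map_mul, map_mul, map_mul]⟩
      zero_mem' := ⟨0, 1, by simp, by simp⟩
      neg_mem' := by
        rintro _ ⟨r, s, hs, rfl⟩
        exact ⟨-r, s, hs, by rw [map_neg, neg_div]⟩ }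
  have hπ : ι (AdjoinRoot.root _ - algebraMap K _ b) = y K q₀ - algebraMap K _ b := by
    rw [map_sub]; rfl
  have hR : ∀ f, f ∈ R ∨ f⁻¹ ∈ R := by
    intro f
    by_cases hf : f = 0
    · exact Or.inl (hf ▸ R.zero_mem)
    · obtain ⟨n, r, s, hr, hs, rfl⟩ := exists_eq_zpow_mul hqp hab hf
      obtain ⟨n, rfl | rfl⟩ := n.eq_nat_or_neg
      · refine Or.inl ⟨(AdjoinRoot.root _ - algebraMap K _ b) ^ n * r, s, hs, ?_⟩
        rw [map_mul, map_pow, hπ, zpow_natCast, mul_div_assoc]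
      · refine Or.inr ⟨(AdjoinRoot.root _ - algebraMap K _ b) ^ n * s, r, hr, ?_⟩
        rw [map_mul, map_pow, hπ, zpow_neg, zpow_natCast, mul_inv, inv_inv, inv_div, mul_div_assoc]
  -- A nonzero function vanishing at the point is not invertible in `R`. This gives both properness
  -- of `R` and the vanishing of `x - a` and `y - b`.
  have hzero : ∀ g : A, evalAt a b hab g = 0 → (ι g)⁻¹ ∈ R → g = 0 := by
    rintro g hg ⟨r, s, hs, hrs⟩
    by_contra hg0
    have hg0' : ι g ≠ 0 := by rwa [Ne, FaithfulSMul.algebraMap_eq_zero_iff]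
    rw [inv_eq_one_div, div_eq_div_iff hg0' (hne s hs), one_mul, ← map_mul] at hrs
    have := IsFractionRing.injective A (HermitianField K q₀) hrs
    rw [this, map_mul, hg, mul_zero] at hs
    exact hs rfl
  have hmem : ∀ g : A, ι g ∈ R := fun g => ⟨g, 1, by simp, by simp⟩
  let P : HermitianCurve K q₀ :=
    { ring := ValuationSubring.ofSubring R hR
      algebraMap_mem := fun c => hmem (algebraMap K A c)
      ne_top := fun h => by
        refine root_sub_ne_zero (q₀ := q₀) b (hzero _ (by simp [evalAt_root]) ?_)
        have := ValuationSubring.mem_top ((ι (AdjoinRoot.root _ - algebraMap K _ b))⁻¹)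
        rwa [← h] at this }
  have hP : ∀ g : A, evalAt a b hab g = 0 → P.IsZero (ι g) := by
    intro g hg
    rw [Place.IsZero, ValuationSubring.mem_nonunits_iff_or]
    by_cases hg0 : g = 0
    · exact Or.inl (by rw [hg0, map_zero])
    · exact Or.inr fun h => hg0 (hzero g hg h)
  refine ⟨P, ?_, ?_⟩
  · have := hP (AdjoinRoot.of _ X - algebraMap K _ a) (by simp [evalAt_of])
    rwa [map_sub] at this
  · have := hP (AdjoinRoot.root _ - algebraMap K _ b) (by simp [evalAt_root])
    rwa [map_sub] at this

/-- Over an algebraically closed field every point that is not at infinity has coordinates. -/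
theorem exists_hasCoords_of_not_isInfinite [IsAlgClosed K] {P : HermitianCurve K q₀}
    (hP : ¬ IsInfinite P) : ∃ a b : K, HasCoords P a b := by
  have hx : x K q₀ ∈ P.ring := not_not.mp fun h => hP (Or.inl h)
  have hy : y K q₀ ∈ P.ring := not_not.mp fun h => hP (Or.inr h)
  let A := AdjoinRoot (hermitianPolynomial K q₀)
  let j : A →+* P.ring := (algebraMap A (HermitianField K q₀)).codRestrict P.ring.toSubring
    (algebraMap_mem_ring hx hy)
  let 𝔭 : Ideal A := (IsLocalRing.maximalIdeal P.ring).comap j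
  have hmem : ∀ g : A, g ∈ 𝔭 ↔ P.IsZero (algebraMap A _ g) := by
    intro g
    rw [Ideal.mem_comap, ← ValuationSubring.coe_mem_nonunits_iff]
    rfl
  -- Otherwise all denominators are units at `P` and the local ring is the whole field.
  have h𝔭 : 𝔭 ≠ ⊥ := by
    intro hbot
    apply P.ne_top
    rw [eq_top_iff]
    intro f _
    obtain ⟨g, h, hh, rfl⟩ := IsFractionRing.div_surjective (A := A) f
    rw [div_eq_mul_inv]
    refine mul_mem (algebraMap_mem_ring hx hy g) ?_
    by_contra hinv
    have hh0 : h ∈ 𝔭 := by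
      rw [hmem, Place.IsZero, ValuationSubring.mem_nonunits_iff_or]
      exact Or.inr hinv
    rw [hbot] at hh0
    exact nonZeroDivisors.ne_zero hh hh0
  have hmonic : (hermitianPolynomial K q₀).Monic := monic_X_pow_sub_C _ (Nat.succ_ne_zero _)
  have hfin : Module.Finite K[X] A := hmonic.finite_adjoinRoot
  have hint : Algebra.IsIntegral K[X] A := inferInstance
  -- By integrality over `K[X]`, a nonzero polynomial in `x` vanishes at `P`; this forces `x` to
  -- take a value in `K`, and the curve equation then does so for `y`.
  have hcomap : 𝔭.comap (algebraMap K[X] A) ≠ ⊥ := fun h =>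
    h𝔭 (Ideal.eq_bot_of_comap_eq_bot (R := K[X]) h)
  obtain ⟨r, hr, hr0⟩ := Submodule.exists_mem_ne_zero_of_ne_bot hcomap
  have haeval : ∀ r : K[X], algebraMap A (HermitianField K q₀) (AdjoinRoot.of _ r)
      = aeval (x K q₀) r := by
    have h : ((algebraMap A (HermitianField K q₀)).comp (AdjoinRoot.of _))
        = (aeval (x K q₀) : K[X] →ₐ[K] HermitianField K q₀).toRingHom :=
      Polynomial.ringHom_ext (fun c => by simp; rfl) (by simp [x, A])
    exact fun r => DFunLike.congr_fun h r
  obtain ⟨a, ha⟩ := Place.exists_isZero_sub_of_aeval hx hr0 (by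
    rw [← haeval]
    exact (hmem _).mp hr)
  obtain ⟨b, hb⟩ := Place.exists_isZero_sub_of_aeval hy
    (p := X ^ (q₀ + 1) - C (a ^ q₀ + a)) (X_pow_sub_C_ne_zero (Nat.succ_pos _) _) (by
      have := (ha.pow_sub_pow q₀).add ha
      convert this using 1
      rw [map_sub, map_pow, aeval_X, aeval_C, hermitian_equation, map_add]
      ring)
  exact ⟨a, b, ha, hb⟩

end Hermitian

/-! ### Automorphisms of the Hermitian function field. -/

namespace Hermitian

open Place

section Endomorphism

variable {K : Type*} [Field K] {q₀ : ℕ}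

theorem eval₂_hermitianPolynomial {R : Type*} [CommRing R] (f : K[X] →+* R) (r : R) :
    (hermitianPolynomial K q₀).eval₂ f r = r ^ (q₀ + 1) - f (X ^ q₀ + X) := by
  rw [hermitianPolynomial, eval₂_sub, eval₂_X_pow, eval₂_C]

theorem isIntegral_of_comp_eq_id {L : Type*} [Field L] [Algebra K L] {σ σ' : L →ₐ[K] L}
    (h : ∀ f, σ (σ' f) = f) : σ.toRingHom.IsIntegral :=
  RingHom.isIntegral_of_surjective _ fun f => ⟨σ' f, h f⟩

variable [hq : Fact (IsPrimePow q₀)]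

/-- The two coordinate functions generate the function field. The polynomial is arbitrary because
both curves are needed. -/
theorem fractionRing_adjoinRoot_algHom_ext {r : K[X][X]} [IsDomain (AdjoinRoot r)] {N : Type*}
    [Field N] [Algebra K N] {f g : FractionRing (AdjoinRoot r) →ₐ[K] N}
    (hof : f (algebraMap _ _ (AdjoinRoot.of r X)) = g (algebraMap _ _ (AdjoinRoot.of r X)))
    (hroot : f (algebraMap _ _ (AdjoinRoot.root r)) = g (algebraMap _ _ (AdjoinRoot.root r))) :
    f = g := by
  have hof : ∀ s : K[X], f (algebraMap _ _ (AdjoinRoot.of r s))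
      = g (algebraMap _ _ (AdjoinRoot.of r s)) := by
    intro s
    induction s using Polynomial.induction_on' with
    | add s t hs ht => simp only [map_add, hs, ht]
    | monomial n c =>
      have hc : ∀ h : FractionRing (AdjoinRoot r) →ₐ[K] N,
          h (algebraMap _ _ (AdjoinRoot.of r (C c))) = algebraMap K N c := fun h => h.commutes c
      rw [← C_mul_X_pow_eq_monomial]
      simp only [map_mul, map_pow, hc, hof]
  have hring : ∀ u : AdjoinRoot r, f (algebraMap _ _ u) = g (algebraMap _ _ u) := by
    intro u
    induction u using AdjoinRoot.induction_on with
    | ih s =>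
      induction s using Polynomial.induction_on' with
      | add s t hs ht => simp only [map_add, hs, ht]
      | monomial n c =>
        rw [← C_mul_X_pow_eq_monomial]
        simp only [map_mul, map_pow, AdjoinRoot.mk_C, AdjoinRoot.mk_X, hof, hroot]
  apply AlgHom.ext
  intro u
  obtain ⟨a, b, _, rfl⟩ := IsFractionRing.div_surjective (A := AdjoinRoot r) u
  rw [map_div₀, map_div₀, hring, hring]

theorem hermitianField_algHom_ext {N : Type*} [Field N] [Algebra K N]
    {f g : HermitianField K q₀ →ₐ[K] N} (hx : f (x K q₀) = g (x K q₀))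
    (hy : f (y K q₀) = g (y K q₀)) : f = g :=
  fractionRing_adjoinRoot_algHom_ext hx hy

variable {ξ η : HermitianField K q₀} (hη : η ^ (q₀ + 1) = ξ ^ q₀ + ξ)

/-- The homomorphism from the coordinate ring given by a nonconstant solution of the equation. -/
def endoRing : AdjoinRoot (hermitianPolynomial K q₀) →ₐ[K] HermitianField K q₀ :=
  AdjoinRoot.liftAlgHom (hermitianPolynomial K q₀) (aeval ξ) η (by
    rw [eval₂_hermitianPolynomial, sub_eq_zero]
    simpa using hη)

/-- By integrality a nonzero kernel would contain a nonzero polynomial in `x`, which would be an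
algebraic relation for `ξ`. -/
theorem endoRing_injective (hξ : Transcendental K ξ) : Function.Injective (endoRing hη) := by
  have hmonic : (hermitianPolynomial K q₀).Monic := monic_X_pow_sub_C _ (Nat.succ_ne_zero _)
  have hfin : Module.Finite K[X] (AdjoinRoot (hermitianPolynomial K q₀)) :=
    hmonic.finite_adjoinRoot
  have hint : Algebra.IsIntegral K[X] (AdjoinRoot (hermitianPolynomial K q₀)) :=
    inferInstance
  change Function.Injective (endoRing hη).toRingHom
  rw [RingHom.injective_iff_ker_eq_bot]
  refine Ideal.eq_bot_of_comap_eq_bot (R := K[X]) ?_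
  rw [eq_bot_iff]
  intro r hr
  have hr' : endoRing hη (AdjoinRoot.of _ r) = 0 := hr
  rw [endoRing, AdjoinRoot.liftAlgHom_of] at hr'
  exact (transcendental_iff.mp hξ) r hr'

variable (hξ : Transcendental K ξ)

/-- The endomorphism of the function field given by a nonconstant solution of the equation. -/
def endo : HermitianField K q₀ →ₐ[K] HermitianField K q₀ :=
  IsFractionRing.liftAlgHom (endoRing_injective hη hξ)

theorem endo_x : endo hη hξ (x K q₀) = ξ := by
  rw [endo, x, IsFractionRing.liftAlgHom_apply, IsFractionRing.lift_algebraMap]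
  simp [endoRing]

theorem endo_y : endo hη hξ (y K q₀) = η := by
  rw [endo, y, IsFractionRing.liftAlgHom_apply, IsFractionRing.lift_algebraMap]
  simp [endoRing]

theorem x_ne_zero : x K q₀ ≠ 0 := fun h =>
  transcendental_x K q₀ (h ▸ isAlgebraic_zero)

theorem y_ne_zero : y K q₀ ≠ 0 := by simpa using y_sub_ne_zero (K := K) (q₀ := q₀) 0

variable (K q₀)

/-- The involution `(x, y) ↦ (1 / x, y / x)`, which exchanges `(0, 0)` and the point at
infinity. -/
def swap : HermitianField K q₀ →ₐ[K] HermitianField K q₀ :=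
  endo (ξ := (x K q₀)⁻¹) (η := y K q₀ / x K q₀)
    (by
      have := x_ne_zero (K := K) (q₀ := q₀)
      rw [div_pow, hermitian_equation]
      rw [inv_pow]
      field_simp
      ring)
    (fun h => transcendental_x K q₀ (by simpa using h.inv))

theorem swap_x : swap K q₀ (x K q₀) = (x K q₀)⁻¹ := endo_x _ _

theorem swap_y : swap K q₀ (y K q₀) = y K q₀ / x K q₀ := endo_y _ _

theorem swap_swap (f : HermitianField K q₀) : swap K q₀ (swap K q₀ f) = f := by
  have h : (swap K q₀).comp (swap K q₀) = AlgHom.id K _ := by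
    have := x_ne_zero (K := K) (q₀ := q₀)
    apply hermitianField_algHom_ext <;> simp [swap_x, swap_y, this]
  exact DFunLike.congr_fun h f

theorem swap_isIntegral : (swap K q₀).toRingHom.IsIntegral :=
  isIntegral_of_comp_eq_id (swap_swap K q₀)

variable {K q₀} {ζ : K}

/-- The automorphism `(x, y) ↦ (ζ ^ (q₀ + 1) * x, ζ * y)`. -/
def scale (hζ : ζ ^ (q₀ ^ 2 - 1) = 1) : HermitianField K q₀ →ₐ[K] HermitianField K q₀ :=
  endo (ξ := algebraMap K _ (ζ ^ (q₀ + 1)) * x K q₀) (η := algebraMap K _ ζ * y K q₀)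
    (by
      -- The norm `ζ ^ (q₀ + 1)` is fixed by the `q₀`-power map, so both sides of the curve equation
      -- scale by it.
      have hpow : (ζ ^ (q₀ + 1)) ^ q₀ = ζ ^ (q₀ + 1) := by
        have h2 : 1 ≤ q₀ ^ 2 := Nat.one_le_pow _ _ hq.out.pos
        rw [← pow_mul, show (q₀ + 1) * q₀ = q₀ ^ 2 - 1 + (q₀ + 1) by
          zify [h2]; ring, pow_add, hζ, one_mul]
      rw [mul_pow, mul_pow, hermitian_equation, ← map_pow, ← map_pow, hpow, mul_add])
    (fun h => by
      have hζ0 : ζ ≠ 0 := by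
        rintro rfl
        have h2 : 2 ^ 2 ≤ q₀ ^ 2 := Nat.pow_le_pow_left hq.out.two_le 2
        rw [zero_pow (by omega)] at hζ
        exact zero_ne_one hζ
      have h' := (isAlgebraic_algebraMap (R := K) (A := HermitianField K q₀)
        (ζ ^ (q₀ + 1))⁻¹).mul h
      rw [← mul_assoc, ← map_mul, inv_mul_cancel₀ (pow_ne_zero _ hζ0), map_one, one_mul] at h'
      exact transcendental_x K q₀ h')

variable (hζ : ζ ^ (q₀ ^ 2 - 1) = 1)

theorem scale_x : scale hζ (x K q₀) = algebraMap K _ (ζ ^ (q₀ + 1)) * x K q₀ := endo_x _ _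

theorem scale_y : scale hζ (y K q₀) = algebraMap K _ ζ * y K q₀ := endo_y _ _

theorem scale_scale_inv (hζ' : ζ⁻¹ ^ (q₀ ^ 2 - 1) = 1) (f : HermitianField K q₀) :
    scale hζ (scale hζ' f) = f := by
  have hζ0 : algebraMap K (HermitianField K q₀) ζ ≠ 0 := by
    have h2 : 2 ^ 2 ≤ q₀ ^ 2 := Nat.pow_le_pow_left hq.out.two_le 2
    have h : ζ ≠ 0 := by
      rintro rfl
      rw [zero_pow (by omega)] at hζ
      exact zero_ne_one hζ
    simpa using h
  have h : (scale hζ).comp (scale hζ') = AlgHom.id K (HermitianField K q₀) := by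
    apply hermitianField_algHom_ext
    · rw [AlgHom.comp_apply, scale_x, map_mul, AlgHom.commutes, scale_x, ← mul_assoc, ← map_mul,
        inv_pow, inv_mul_cancel₀ (pow_ne_zero _ (by simpa using hζ0)), map_one, one_mul,
        AlgHom.id_apply]
    · rw [AlgHom.comp_apply, scale_y, map_mul, AlgHom.commutes, scale_y, ← mul_assoc, ← map_mul,
        inv_mul_cancel₀ (by simpa using hζ0), map_one, one_mul, AlgHom.id_apply]
  exact DFunLike.congr_fun h f

theorem scale_isIntegral : (scale (q₀ := q₀) hζ).toRingHom.IsIntegral :=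
  isIntegral_of_comp_eq_id (scale_scale_inv hζ (by rw [inv_pow, hζ, inv_one]))

/-- The function `x ^ (q₀ - 1)` scales by `ζ ^ (q₀ ^ 2 - 1) = 1` and `y ^ m` by `ζ ^ m = 1`. -/
theorem scale_phi (m : ℕ) [hm : Fact (m ∣ q₀ ^ 2 - 1)] (hm1 : ζ ^ m = 1)
    (f : QuotientField K q₀ m) : scale hζ (phi K q₀ m f) = phi K q₀ m f := by
  have hfac : (q₀ + 1) * (q₀ - 1) = q₀ ^ 2 - 1 := by simpa using (Nat.sq_sub_sq q₀ 1).symm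
  have h : (scale hζ).comp (phi K q₀ m) = phi K q₀ m := by
    apply fractionRing_adjoinRoot_algHom_ext
    · change scale hζ (phi K q₀ m (t K q₀ m)) = phi K q₀ m (t K q₀ m)
      rw [phi_t, map_pow, scale_x, mul_pow, ← map_pow, ← pow_mul, hfac, hζ, map_one, one_mul]
    · change scale hζ (phi K q₀ m (z K q₀ m)) = phi K q₀ m (z K q₀ m)
      rw [phi_z, map_pow, scale_y, mul_pow, ← map_pow, hm1, map_one, one_mul]
  exact DFunLike.congr_fun h f

end Endomorphism

end Hermitian

/-! ### The point at infinity. -/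

namespace Hermitian

open Place

section Infinity

variable {K : Type*} [Field K] {q₀ : ℕ} [hq : Fact (IsPrimePow q₀)]

theorem Place.image_swap_image_swap (P : HermitianCurve K q₀) :
    (P.image (swap K q₀) (swap_isIntegral K q₀)).image (swap K q₀) (swap_isIntegral K q₀) = P := by
  apply Place.ext
  ext f
  rw [mem_image_ring, mem_image_ring, swap_swap]

/-- A pole of `y` forces one of `x`, because `y ^ (q₀ + 1)` is a polynomial in `x`. -/
theorem isInfinite_iff {P : HermitianCurve K q₀} : IsInfinite P ↔ P.IsZero (x K q₀)⁻¹ := by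
  rw [← isPole_iff_isZero_inv x_ne_zero]
  refine ⟨fun h => h.elim id fun hy hx => hy ?_, Or.inl⟩
  have : y K q₀ ^ (q₀ + 1) ∈ P.ring := by
    rw [hermitian_equation]
    exact add_mem (pow_mem hx _) hx
  rw [← ValuationSubring.valuation_le_one_iff, map_pow, pow_le_one_iff (Nat.succ_ne_zero _)] at this
  exact (P.ring.valuation_le_one_iff _).mp this

/-- Applying `swap` to the curve equation gives `(y / x) ^ (q₀ + 1) = x⁻¹ (1 + x⁻¹ ^ (q₀ - 1))`,
whose last factor has value `1` at a pole of `x`. So `1 / x` has order `q₀ + 1` at infinity. -/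
theorem valuation_y_div_x_pow {P : HermitianCurve K q₀} (hP : IsInfinite P) :
    P.ring.valuation (y K q₀ / x K q₀) ^ (q₀ + 1) = P.ring.valuation (x K q₀)⁻¹ := by
  have h2 : 2 ≤ q₀ := hq.out.two_le
  have hx := isInfinite_iff.mp hP
  have heq : (y K q₀ / x K q₀) ^ (q₀ + 1) = (x K q₀)⁻¹ * (1 + (x K q₀)⁻¹ ^ (q₀ - 1)) := by
    have h := hermitian_equation K q₀
    have h' := congrArg (swap K q₀) h
    rw [map_pow, swap_y, map_add, map_pow, swap_x] at h'
    rw [h', mul_add, mul_one, ← pow_succ', Nat.sub_add_cancel (by omega), add_comm]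
  rw [← map_pow, heq, map_mul, Valuation.map_one_add_of_lt, mul_one]
  rw [map_pow]
  exact pow_lt_one₀ zero_le (isZero_iff_valuation_lt_one.mp hx) (by omega)

theorem isInfinite_iff_hasCoords {P : HermitianCurve K q₀} :
    IsInfinite P ↔ HasCoords (P.image (swap K q₀) (swap_isIntegral K q₀)) 0 0 := by
  rw [HasCoords, map_zero, sub_zero, sub_zero, isZero_image_iff, isZero_image_iff, swap_x, swap_y]
  refine ⟨fun hP => ⟨isInfinite_iff.mp hP, ?_⟩, fun h => isInfinite_iff.mpr h.1⟩
  have := isInfinite_iff.mp hP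
  rw [isZero_iff_valuation_lt_one, ← valuation_y_div_x_pow hP,
    pow_lt_one_iff (Nat.succ_ne_zero _)] at this
  exact isZero_iff_valuation_lt_one.mpr this

variable {p k : ℕ} [Fact p.Prime] [CharP K p]

theorem IsInfinite.unique (hqp : q₀ = p ^ k) {P Q : HermitianCurve K q₀} (hP : IsInfinite P)
    (hQ : IsInfinite Q) : P = Q := by
  rw [← P.image_swap_image_swap, ← Q.image_swap_image_swap,
    (isInfinite_iff_hasCoords.mp hP).unique hqp (isInfinite_iff_hasCoords.mp hQ)]

theorem exists_isInfinite (hqp : q₀ = p ^ k) : ∃ P : HermitianCurve K q₀, IsInfinite P := by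
  have h2 : 2 ≤ q₀ := hq.out.two_le
  obtain ⟨P, hP⟩ := exists_hasCoords (q₀ := q₀) (K := K) hqp (a := 0) (b := 0) (by
    rw [zero_pow (by omega), zero_pow (by omega), add_zero])
  exact ⟨P.image _ (swap_isIntegral K q₀), isInfinite_iff_hasCoords.mpr
    (by rwa [P.image_swap_image_swap])⟩

theorem IsInfinite.isUniformizer (hqp : q₀ = p ^ k) {P : HermitianCurve K q₀}
    (hP : IsInfinite P) : P.IsUniformizer (y K q₀ / x K q₀) := by
  have h := ((isInfinite_iff_hasCoords.mp hP).isUniformizer hqp).of_image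
    (hσ := swap_isIntegral K q₀) (swap_swap K q₀)
  rwa [P.image_swap_image_swap, map_zero, sub_zero, swap_y] at h

theorem IsInfinite.exists_isZero_sub (hqp : q₀ = p ^ k) {P : HermitianCurve K q₀}
    (hP : IsInfinite P) {u : HermitianField K q₀} (hu : P.ring.valuation u = 1) :
    ∃ c : K, P.IsZero (u - algebraMap K _ c) := by
  have hu' : (P.image (swap K q₀) (swap_isIntegral K q₀)).ring.valuation (swap K q₀ u) = 1 := by
    rw [← map_one (P.image (swap K q₀) (swap_isIntegral K q₀)).ring.valuation]
    apply le_antisymm <;> rw [valuation_image_le_iff, swap_swap, map_one, map_one, hu]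
  obtain ⟨c, hc⟩ := (isInfinite_iff_hasCoords.mp hP).exists_isZero_sub hqp hu'
  refine ⟨c, ?_⟩
  rwa [isZero_image_iff, map_sub, swap_swap, AlgHom.commutes] at hc

end Infinity

/-! ### The ramification index at each kind of point. -/

section RamIndex

variable {K : Type*} [Field K] {q₀ m : ℕ} [hq : Fact (IsPrimePow q₀)]
  [hm : Fact (m ∣ q₀ ^ 2 - 1)]

theorem sq_sub_one_pos : 0 < q₀ ^ 2 - 1 := by
  have : 2 ^ 2 ≤ q₀ ^ 2 := Nat.pow_le_pow_left hq.out.two_le 2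
  omega

variable {p k : ℕ} [CharP K p]

theorem cast_q_eq_zero (hqp : q₀ = p ^ k) : (q₀ : K) = 0 := by
  rw [CharP.cast_eq_zero_iff K p, hqp]
  refine dvd_pow_self p ?_
  rintro rfl
  exact hq.out.one_lt.ne' (by simpa using hqp)

/-- In `K` the number `q₀ ^ 2 - 1` equals `-1`. -/
theorem cast_ne_zero_of_dvd (hqp : q₀ = p ^ k) {n : ℕ} (hn : n ∣ q₀ ^ 2 - 1) : (n : K) ≠ 0 := by
  obtain ⟨c, hc⟩ := hn
  intro h
  have h1 : ((q₀ ^ 2 - 1 : ℕ) : K) = 0 := by rw [hc, Nat.cast_mul, h, zero_mul]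
  rw [Nat.cast_sub (Nat.one_le_pow _ _ hq.out.pos), Nat.cast_pow, cast_q_eq_zero hqp] at h1
  simp at h1

theorem exists_isPrimitiveRoot [IsAlgClosed K] (hqp : q₀ = p ^ k) {n : ℕ} (hn : n ∣ q₀ ^ 2 - 1) :
    ∃ ζ : K, IsPrimitiveRoot ζ n := by
  have : NeZero (n : K) := ⟨cast_ne_zero_of_dvd hqp hn⟩
  exact HasEnoughRootsOfUnity.exists_primitiveRoot K n

variable [Fact p.Prime]

/-- The hypothesis `hζa` says that scaling by `ζ` fixes `(a, 0)`. It is automatic for `a = 0`; for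
`a ≠ 0` it requires `ζ ^ (q₀ + 1) = 1`, which is why `gcd m (q₀ + 1)` appears. -/
theorem HasCoords.dvd_of_valuation_phi (hqp : q₀ = p ^ k) {P : HermitianCurve K q₀} {a : K}
    (hP : HasCoords P a 0) {n : ℕ} (hnm : n ∣ m) {ζ : K} (hζ : IsPrimitiveRoot ζ n)
    (hζa : ζ ^ (q₀ + 1) * a = a) (f : QuotientField K q₀ m) (l : ℤ)
    (hl : P.ring.valuation (phi K q₀ m f) = P.ring.valuation (y K q₀) ^ l) : (n : ℤ) ∣ l := by
  have hn : n ∣ q₀ ^ 2 - 1 := hnm.trans hm.out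
  have hζq : ζ ^ (q₀ ^ 2 - 1) = 1 := (hζ.pow_eq_one_iff_dvd _).mpr hn
  have hπ := hP.isUniformizer hqp
  rw [map_zero, sub_zero] at hπ
  have himage : HasCoords (P.image (scale hζq) (scale_isIntegral hζq)) a 0 := by
    rw [HasCoords, isZero_image_iff, isZero_image_iff]
    constructor
    · have := hP.1.mul_right (P.algebraMap_mem (ζ ^ (q₀ + 1)))
      rwa [sub_mul, ← map_mul, mul_comm a, hζa, mul_comm (x K q₀), ← scale_x hζq,
        ← AlgHom.commutes (scale hζq), ← map_sub] at this
    · have := hP.2.mul_right (P.algebraMap_mem ζ)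
      rwa [map_zero, sub_zero, mul_comm, ← scale_y hζq, ← sub_zero (y K q₀),
        ← map_zero (algebraMap K (HermitianField K q₀))] at this
  exact hπ.dvd_of_map_eq_self (fun u hu => hP.exists_isZero_sub hqp hu)
    (himage.unique hqp hP) hζ (Nat.pos_of_dvd_of_pos hn sq_sub_one_pos).ne' (scale_y hζq)
    (scale_phi hζq m ((hζ.pow_eq_one_iff_dvd _).mpr hnm) f) hl

theorem HasCoords.ramIndex_zero_zero [IsAlgClosed K] (hqp : q₀ = p ^ k) {P : HermitianCurve K q₀}
    (hP : HasCoords P 0 0) : ramIndex K q₀ m P = m := by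
  obtain ⟨ζ, hζ⟩ := exists_isPrimitiveRoot (K := K) hqp hm.out
  have hπ := hP.isUniformizer hqp
  rw [map_zero, sub_zero] at hπ
  refine hπ.ramificationIndex_eq _ _ (Nat.pos_of_dvd_of_pos hm.out sq_sub_one_pos)
    (hP.dvd_of_valuation_phi hqp dvd_rfl hζ (mul_zero _)) (g := z K q₀ m) ?_
  rw [phi_z, map_pow]

theorem HasCoords.ramIndex_of_pow_eq_neg_one [IsAlgClosed K] (hqp : q₀ = p ^ k)
    {P : HermitianCurve K q₀} {a : K} (ha : a ^ (q₀ - 1) = -1) (hP : HasCoords P a 0) :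
    ramIndex K q₀ m P = Nat.gcd m (q₀ + 1) := by
  have h2 : 2 ≤ q₀ := hq.out.two_le
  have hdm : Nat.gcd m (q₀ + 1) ∣ m := Nat.gcd_dvd_left _ _
  have ha0 : a ≠ 0 := by
    rintro rfl
    rw [zero_pow (by omega)] at ha
    simp at ha
  obtain ⟨ζ, hζ⟩ := exists_isPrimitiveRoot (K := K) hqp (hdm.trans hm.out)
  have hζa : ζ ^ (q₀ + 1) * a = a := by
    rw [(hζ.pow_eq_one_iff_dvd _).mpr (Nat.gcd_dvd_right _ _), one_mul]
  have hπ := hP.isUniformizer hqp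
  rw [map_zero, sub_zero] at hπ
  have hx : P.ring.valuation (x K q₀) = 1 :=
    hP.valuation_eq_one (g := AdjoinRoot.of _ X) (by simpa [evalAt_of] using ha0)
  -- Here `y ^ (q₀ + 1) = x * (t + 1)` and `x` is a unit, so `t + 1` has order `q₀ + 1`.
  have ht : P.ring.valuation (phi K q₀ m (t K q₀ m + 1))
      = P.ring.valuation (y K q₀) ^ (q₀ + 1) := by
    rw [map_add, phi_t, map_one, ← map_pow, hermitian_equation,
      show x K q₀ ^ q₀ + x K q₀ = x K q₀ * (x K q₀ ^ (q₀ - 1) + 1) by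
        rw [mul_add, mul_one, ← pow_succ', Nat.sub_add_cancel (by omega)], map_mul, hx, one_mul]
  have hz : P.ring.valuation (phi K q₀ m (z K q₀ m)) = P.ring.valuation (y K q₀) ^ m := by
    rw [phi_z, map_pow]
  refine hπ.ramificationIndex_eq _ _
    (Nat.pos_of_dvd_of_pos (hdm.trans hm.out) sq_sub_one_pos)
    (hP.dvd_of_valuation_phi hqp hdm hζ hζa)
    -- Bézout coefficients turn the orders `m` of `z` and `q₀ + 1` of `t + 1` into their greatest
    -- common divisor.
    (g := z K q₀ m ^ Nat.gcdA m (q₀ + 1) * (t K q₀ m + 1) ^ Nat.gcdB m (q₀ + 1)) ?_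
  rw [map_mul, map_mul, map_zpow₀, map_zpow₀, map_zpow₀, map_zpow₀, hz, ht, ← zpow_natCast,
    ← zpow_natCast, ← zpow_natCast, Nat.gcd_eq_gcd_ab, zpow_add₀ hπ.valuation_pos.ne', zpow_mul,
    zpow_mul]

/-- The cofactor of `y - b` in `y ^ m - b ^ m` takes the value `m * b ^ (m - 1)` at the point,
nonzero because `m` is prime to the characteristic. -/
theorem HasCoords.ramIndex_of_ne_zero (hqp : q₀ = p ^ k) {P : HermitianCurve K q₀} {a b : K}
    (hb : b ≠ 0) (hP : HasCoords P a b) : ramIndex K q₀ m P = 1 := by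
  refine (hP.isUniformizer hqp).ramificationIndex_eq _ _ one_pos
    (fun _ l _ => by simp) (g := z K q₀ m - algebraMap K _ (b ^ m)) ?_
  let g : AdjoinRoot (hermitianPolynomial K q₀) :=
    ∑ i ∈ Finset.range m, AdjoinRoot.root _ ^ i * algebraMap K _ b ^ (m - 1 - i)
  have hg : evalAt a b hP.equation g ≠ 0 := by
    have : evalAt a b hP.equation g = m * b ^ (m - 1) := by
      rw [← geom_sum₂_self]
      simp [g, evalAt_root]
    rw [this]
    exact mul_ne_zero (cast_ne_zero_of_dvd hqp hm.out) (pow_ne_zero _ hb)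
  have heq : y K q₀ ^ m - algebraMap K _ b ^ m
      = algebraMap _ (HermitianField K q₀) g * (y K q₀ - algebraMap K _ b) := by
    rw [← (Commute.all _ _).geom_sum₂_mul]
    congr 1
    simp only [g, map_sum, map_mul, map_pow, ← IsScalarTower.algebraMap_apply]
    rfl
  rw [map_sub, phi_z, AlgHom.commutes, map_pow (algebraMap K _), heq, map_mul,
    hP.valuation_eq_one hg, one_mul, pow_one]

theorem IsInfinite.ramIndex [IsAlgClosed K] (hqp : q₀ = p ^ k) {P : HermitianCurve K q₀}
    (hP : IsInfinite P) : ramIndex K q₀ m P = m := by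
  have h2 : 2 ≤ q₀ := hq.out.two_le
  obtain ⟨ζ, hζ⟩ := exists_isPrimitiveRoot (K := K) hqp hm.out
  have hm0 : m ≠ 0 := (Nat.pos_of_dvd_of_pos hm.out sq_sub_one_pos).ne'
  have hζ0 : ζ ≠ 0 := hζ.ne_zero hm0
  have hζq : ζ ^ (q₀ ^ 2 - 1) = 1 := (hζ.pow_eq_one_iff_dvd _).mpr hm.out
  have hπ := hP.isUniformizer hqp
  have himage : IsInfinite (P.image (scale hζq) (scale_isIntegral hζq)) := by
    rw [isInfinite_iff] at hP ⊢
    rw [isZero_image_iff, map_inv₀, scale_x, mul_inv, mul_comm, ← map_inv₀]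
    exact hP.mul_right (P.algebraMap_mem _)
  have hcop : Nat.Coprime q₀ m := by
    refine Nat.Coprime.coprime_dvd_right hm.out ?_
    have h1 : 1 ≤ q₀ ^ 2 := Nat.one_le_pow _ _ hq.out.pos
    have := (Nat.coprime_self_sub_right h1).mpr (Nat.coprime_one_right (q₀ ^ 2))
    exact Nat.Coprime.coprime_dvd_left (dvd_pow_self q₀ two_ne_zero) this
  -- The factor is `ζ / ζ ^ (q₀ + 1)`; it is again a primitive `m`-th root of unity, as `q₀` is
  -- prime to `m`.
  have hscale : scale hζq (y K q₀ / x K q₀)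
      = algebraMap K _ (ζ⁻¹ ^ q₀) * (y K q₀ / x K q₀) := by
    have h0 : algebraMap K (HermitianField K q₀) ζ ≠ 0 := by simpa using hζ0
    have hx0 := x_ne_zero (K := K) (q₀ := q₀)
    rw [map_div₀, scale_x, scale_y, map_pow, map_pow, map_inv₀, pow_succ, inv_pow]
    field_simp
  refine hπ.ramificationIndex_eq _ _ (Nat.pos_of_ne_zero hm0) (fun f l hl =>
    hπ.dvd_of_map_eq_self (fun u hu => hP.exists_isZero_sub hqp hu) (himage.unique hqp hP)
      (hζ.inv.pow_of_coprime q₀ hcop) hm0 hscale (scale_phi hζq m hζ.pow_eq_one f) hl)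
    -- At infinity `x` and `y` have orders `-(q₀ + 1)` and `-q₀`, so this has order `-m (q₀ ^ 2 - 1)
    -- + m q₀ ^ 2 = m`.
    (g := t K q₀ m ^ m / z K q₀ m ^ q₀) ?_
  have hx0 := x_ne_zero (K := K) (q₀ := q₀)
  have hy0 := y_ne_zero (K := K) (q₀ := q₀)
  have heq : phi K q₀ m (t K q₀ m ^ m / z K q₀ m ^ q₀)
      = ((x K q₀)⁻¹ / (y K q₀ / x K q₀) ^ q₀) ^ m := by
    have h1 : (x K q₀)⁻¹ / (y K q₀ / x K q₀) ^ q₀ = x K q₀ ^ (q₀ - 1) / y K q₀ ^ q₀ := by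
      have hpow : x K q₀ ^ q₀ = x K q₀ ^ (q₀ - 1) * x K q₀ := by
        rw [← pow_succ, Nat.sub_add_cancel (by omega)]
      rw [div_pow, hpow]
      field_simp
    rw [map_div₀, map_pow, map_pow, phi_t, phi_z, h1, div_pow, pow_right_comm (y K q₀)]
  have hv0 := hπ.valuation_pos.ne'
  rw [heq, map_pow, map_div₀, map_pow, ← valuation_y_div_x_pow hP, pow_succ,
    mul_div_cancel_left₀ _ (pow_ne_zero _ hv0)]

end RamIndex

end Hermitian

/-! ### Roots of `a ^ n = -1` and the characteristic. -/

namespace Hermitian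

/-- The solutions of `a ^ n = -1` can be listed without repetition by `Fin n`. -/
theorem exists_fin_pow_eq_neg_one {K : Type*} [Field K] [IsAlgClosed K] {n : ℕ}
    (hn : (n : K) ≠ 0) : ∃ α : Fin n → K, Function.Injective α ∧
      ∀ a : K, a ^ n = -1 ↔ ∃ i, α i = a := by
  have hn0 : 0 < n := Nat.pos_of_ne_zero (by rintro rfl; simp at hn)
  -- As `n` is nonzero in `K`, the `n` roots are distinct.
  have hsep : (X ^ n - C (-1 : K)).Separable :=
    separable_X_pow_sub_C _ hn (neg_ne_zero.mpr one_ne_zero)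
  have hcard : Fintype.card ((X ^ n - C (-1 : K)).rootSet K) = n := by
    rw [card_rootSet_eq_natDegree hsep (by simpa using IsAlgClosed.splits _),
      natDegree_X_pow_sub_C]
  let e := (Fintype.equivFinOfCardEq hcard).symm
  refine ⟨fun i => e i, Subtype.val_injective.comp e.injective, fun a => ?_⟩
  have hmem : a ∈ (X ^ n - C (-1 : K)).rootSet K ↔ a ^ n = -1 := by
    rw [mem_rootSet_of_ne (X_pow_sub_C_ne_zero hn0 _), map_sub, map_pow, aeval_X, aeval_C,
      Algebra.algebraMap_self_apply, sub_eq_zero]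
  rw [← hmem]
  exact ⟨fun h => ⟨e.symm ⟨a, h⟩, by simp⟩, by rintro ⟨i, rfl⟩; exact (e i).2⟩

theorem exists_charP_of_card_eq (F K : Type*) [Field F] [Finite F] [Field K] [Algebra F K]
    {q₀ : ℕ} (hq : IsPrimePow q₀) (hF : Nat.card F = q₀ ^ 2) :
    ∃ p k : ℕ, p.Prime ∧ CharP K p ∧ q₀ = p ^ k := by
  obtain ⟨p, k, hp, hk, hqp⟩ := (isPrimePow_nat_iff _).mp hq
  have := Fintype.ofFinite F
  obtain ⟨r, hr⟩ := CharP.exists F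
  obtain ⟨n, hr', hn⟩ := FiniteField.card F r
  have hpr : p = r := by
    rw [← Nat.card_eq_fintype_card, hF, ← hqp, ← pow_mul] at hn
    exact (Nat.prime_dvd_prime_iff_eq hp hr').mp (hp.dvd_of_dvd_pow
      (hn ▸ dvd_pow_self p (by positivity)))
  subst hpr
  exact ⟨p, k, hp, charP_of_injective_algebraMap (algebraMap F K).injective p, hqp.symm⟩

end Hermitian

end

/-! ### The main theorem. -/

theorem mainTheorem7 (F K : Type*) [Field F] [Finite F] [Field K] [Algebra F K]
    [IsAlgClosure F K] (q₀ m : ℕ) [Fact (IsPrimePow q₀)] [Fact (m ∣ q₀ ^ 2 - 1)]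
    (hF : Nat.card F = q₀ ^ 2) :
    ∃ (P₀ Pinf : Hermitian.HermitianCurve K q₀)
      (P : Fin (q₀ - 1) → Hermitian.HermitianCurve K q₀),
      -- `P₀` is the point `(0, 0)`, and `Pinf` is the only point at infinity
      (∀ Q : Hermitian.HermitianCurve K q₀, Hermitian.HasCoords Q 0 0 ↔ Q = P₀) ∧
      (∀ Q : Hermitian.HermitianCurve K q₀, Hermitian.IsInfinite Q ↔ Q = Pinf) ∧
      -- the `P i` are the `q₀ - 1` distinct points `(a, 0)` with `a ^ (q₀ - 1) = -1`
      Function.Injective P ∧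
      (∀ Q : Hermitian.HermitianCurve K q₀,
        (∃ a : K, a ^ (q₀ - 1) = -1 ∧ Hermitian.HasCoords Q a 0) ↔ ∃ i, Q = P i) ∧
      -- ramification indices
      Hermitian.ramIndex K q₀ m P₀ = m ∧
      Hermitian.ramIndex K q₀ m Pinf = m ∧
      (∀ i, Hermitian.ramIndex K q₀ m (P i) = Nat.gcd m (q₀ + 1)) ∧
      (∀ Q : Hermitian.HermitianCurve K q₀, Q ≠ P₀ → Q ≠ Pinf → (∀ i, Q ≠ P i) →
        Hermitian.ramIndex K q₀ m Q = 1) ∧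
      -- the set of ramification points
      (1 < Nat.gcd m (q₀ + 1) →
        {Q | 1 < Hermitian.ramIndex K q₀ m Q} = {P₀, Pinf} ∪ Set.range P) ∧
      (1 < m → Nat.gcd m (q₀ + 1) = 1 →
        {Q | 1 < Hermitian.ramIndex K q₀ m Q} = {P₀, Pinf}) := by
  have hK : IsAlgClosed K := IsAlgClosure.isAlgClosed F
  have hq : IsPrimePow q₀ := Fact.out
  have h2 : 2 ≤ q₀ := hq.two_le
  obtain ⟨p, k, hp, hchar, hqp⟩ := Hermitian.exists_charP_of_card_eq F K hq hF
  have : Fact p.Prime := ⟨hp⟩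
  obtain ⟨α, hα, hαmem⟩ := Hermitian.exists_fin_pow_eq_neg_one (K := K) (n := q₀ - 1)
    (Hermitian.cast_ne_zero_of_dvd hqp ⟨q₀ + 1, by
      rw [mul_comm]; simpa using Nat.sq_sub_sq q₀ 1⟩)
  have hαpow : ∀ i, α i ^ (q₀ - 1) = -1 := fun i => (hαmem _).mpr ⟨i, rfl⟩
  have hfac : ∀ a : K, a ^ q₀ + a = a * (a ^ (q₀ - 1) + 1) := fun a => by
    rw [mul_add, mul_one, ← pow_succ', Nat.sub_add_cancel (by omega)]
  obtain ⟨P₀, hP₀⟩ := Hermitian.exists_hasCoords (q₀ := q₀) (K := K) hqp (a := 0) (b := 0) (by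
    rw [hfac, zero_pow (by omega), zero_mul])
  obtain ⟨Pinf, hPinf⟩ := Hermitian.exists_isInfinite (q₀ := q₀) (K := K) hqp
  have hex : ∀ i, ∃ Q : Hermitian.HermitianCurve K q₀, Hermitian.HasCoords Q (α i) 0 := fun i =>
    Hermitian.exists_hasCoords hqp (by
      rw [hfac, hαpow, neg_add_cancel, mul_zero, zero_pow (by omega)])
  choose P hP using hex
  have h0 : Hermitian.ramIndex K q₀ m P₀ = m := hP₀.ramIndex_zero_zero hqp
  have hinf : Hermitian.ramIndex K q₀ m Pinf = m := hPinf.ramIndex hqp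
  have hi : ∀ i, Hermitian.ramIndex K q₀ m (P i) = Nat.gcd m (q₀ + 1) := fun i =>
    (hP i).ramIndex_of_pow_eq_neg_one hqp (hαpow i)
  have hother : ∀ Q : Hermitian.HermitianCurve K q₀, Q ≠ P₀ → Q ≠ Pinf → (∀ i, Q ≠ P i) →
      Hermitian.ramIndex K q₀ m Q = 1 := by
    intro Q hQ0 hQinf hQi
    obtain ⟨a, b, hQ⟩ := Hermitian.exists_hasCoords_of_not_isInfinite
      (fun h => hQinf (h.unique hqp hPinf))
    refine hQ.ramIndex_of_ne_zero hqp ?_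
    -- If `b = 0` then `a * (a ^ (q₀ - 1) + 1) = 0`, so `Q` would be one of the excluded affine
    -- points.
    rintro rfl
    have heq := hQ.equation
    rw [zero_pow (by omega), hfac, eq_comm, mul_eq_zero, add_eq_zero_iff_eq_neg] at heq
    rcases heq with rfl | ha
    · exact hQ0 (hQ.unique hqp hP₀)
    · obtain ⟨i, rfl⟩ := (hαmem a).mp ha
      exact hQi i (hQ.unique hqp (hP i))
  have hm0 : 0 < m := Nat.pos_of_dvd_of_pos (Fact.out : m ∣ q₀ ^ 2 - 1) Hermitian.sq_sub_one_pos
  refine ⟨P₀, Pinf, P, fun Q => ⟨fun h => h.unique hqp hP₀, fun h => h ▸ hP₀⟩,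
    fun Q => ⟨fun h => h.unique hqp hPinf, fun h => h ▸ hPinf⟩,
    fun i j hij => hα ((hP i).ext_left (hij ▸ hP j)), ?_, h0, hinf, hi, hother, ?_, ?_⟩
  · intro Q
    constructor
    · rintro ⟨a, ha, hQ⟩
      obtain ⟨i, rfl⟩ := (hαmem a).mp ha
      exact ⟨i, hQ.unique hqp (hP i)⟩
    · rintro ⟨i, rfl⟩
      exact ⟨α i, hαpow i, hP i⟩
  · intro hd
    have hm1 : 1 < m := hd.trans_le (Nat.gcd_le_left _ hm0)
    ext Q
    simp only [Set.mem_ofPred_eq, Set.mem_union, Set.mem_insert_iff, Set.mem_singleton_iff,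
      Set.mem_range]
    constructor
    · intro hQ
      by_contra! hne
      exact hQ.ne' (hother Q hne.1.1 hne.1.2 fun i h => hne.2 i h.symm)
    · rintro ((rfl | rfl) | ⟨i, rfl⟩)
      · rwa [h0]
      · rwa [hinf]
      · rwa [hi]
  · intro hm1 hd
    ext Q
    simp only [Set.mem_ofPred_eq, Set.mem_insert_iff, Set.mem_singleton_iff]
    constructor
    · intro hQ
      by_contra! hne
      refine hQ.ne' ?_
      by_cases hQi : ∃ i, Q = P i
      · obtain ⟨i, rfl⟩ := hQi
        rw [hi, hd]
      · exact hother Q hne.1 hne.2 fun i h => hQi ⟨i, h⟩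
    · rintro (rfl | rfl)
      · rwa [h0]
      · rwa [hinf]
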